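/- Let $R$ be a Dedekind domain (fields allowed), let $\mathrm{mod}\,R$ be the abelian category of finitely generated (equivalently, finitely presented) $R$-modules, and let $D=D^b(\mathrm{mod}\,R)$ be its bounded derived category, with homology functors $H_k=H^{-k}:D\to\mathrm{mod}\,R$. All subcategories are full and closed under isomorphisms. Definitions. An aisle in $D$ is a subcategory $U$ closed under the suspension $[1]$ and under extensions, whose embedding $U\to D$ has a right adjoint. Its coaisle is $U[1]^{\perp_0}=\{Y\in D\mid \mathrm{Hom}(X[1],Y)=0 \text{ for all } X\in U\}$; thus $(U,U[1]^{\perp_0})=(D^{\le 0},D^{\ge 0})$ is the corresponding $t$-structure. A torsion theory on an abelian category $\mathcal A$ is a pair $(\mathcal T,\mathcal F)$ of subcategories with $\mathrm{Hom}(\mathcal T,\mathcal F)=0$ such that each $X\in\mathcal A$ has a short exact sequence $0\to T\to X\to F\to 0$ with $T\in\mathcal T$, $F\in\mathcal F$; a torsionfree class is the second member of a torsion theory. A co-narrow sequence in $\mathcal A$ is a family $(C(k))_{k\in\mathbb Z}$ of subcategories of $\mathcal A$, each containing $0$ and closed under extensions and kernels, such that $C(k+1)\subseteq C(k)$ for all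 $k$, and such that for each exact sequence $X_0\to X_1\to X_2\to X_3\to X_4$ with $X_0\in C(k+1)$, $X_1,X_3\in C(k)$, $X_4\in C(k-1)$ one has $X_2\in C(k)$. It is reflective if each embedding $C(k)\to\mathcal A$ has a left adjoint. For $n\in\mathbb Z\cup\{\pm\infty\}$ and a nonzero torsionfree class $\mathcal C\subseteq\mathrm{mod}\,R$ consider the sequence $$C_{n,\mathcal C}(k)=\begin{cases}\mathrm{mod}\,R & k<n,\\ \mathcal C & k=n,\\ 0 & k>n.\end{cases}$$ (1) Each $C_{n,\mathcal C}$ is a reflective co-narrow sequence. The assignment $U\mapsto \big(H_k(U[1]^{\perp_0})\big)_{k\in\mathbb Z}$ is a bijection from the set of aisles in $D$ to the set of all sequences of the form $C_{n,\mathcal C}$, and for each aisle $U$ with sequence $(C(k))_k$ its coaisle is recovered as $U[1]^{\perp_0}=\{X\in D\mid H_k(X)\in C(k)\text{ for all }k\in\mathbb Z\}$. Hence likewise, $(D^{\le 0},D^{\ge 0})\mapsto (H_k(D^{\ge 0}))_k$ is a bijection from the $t$-structures on $D$ to these sequences; for each $t$-structure, $D^{\le 0}$ is an aisle with coaisle $D^{\ge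 0}$, and $D^{\ge 0}=\{X\mid H_k(X)\in H_k(D^{\ge 0})\text{ for all }k\}$. (2) There is an order-reversing bijection $$\{\text{torsionfree classes in }\mathrm{mod}\,R\}\longrightarrow\{\text{specialization closed subsets of }\mathrm{Spec}\,R\},\qquad \mathcal C\mapsto \mathrm{Supp}({}^{\perp_0}\mathcal C),$$ where ${}^{\perp_0}\mathcal C=\{M\in \mathrm{mod}\,R\mid \mathrm{Hom}(M,X)=0\text{ for all }X\in\mathcal C\}$ and $\mathrm{Supp}$ of a subcategory is the union of the supports of its objects; that is, moreover, for torsionfree classes $\mathcal C,\mathcal C'$ one has $\mathcal C\subseteq\mathcal C'$ if and only if $\mathrm{Supp}({}^{\perp_0}\mathcal C')\subseteq\mathrm{Supp}({}^{\perp_0}\mathcal C)$. -/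

import Mathlib

open CategoryTheory CategoryTheory.Limits CategoryTheory.Pretriangulated
  CategoryTheory.Triangulated

universe w v u

noncomputable section

namespace DedekindAisles

section Triangulated

variable {D : Type u} [Category.{v} D] [Preadditive D] [HasZeroObject D] [HasShift D ℤ]
  [∀ n : ℤ, (shiftFunctor D n).Additive] [Pretriangulated D]

/-- A preaisle: a full replete subcategory which is closed under the suspension `[1]` and under
extensions. -/
structure IsPreaisle (U : ObjectProperty D) : Prop where
  closedUnderIso : U.IsClosedUnderIsomorphisms
  closedUnderSuspension : ∀ X : D, U X → U (X⟦(1 : ℤ)⟧)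
  closedUnderExtensions : ∀ T : Triangle D, T ∈ distTriang D → U T.obj₁ → U T.obj₃ → U T.obj₂

/-- An aisle: a preaisle whose embedding has a right adjoint. -/
structure IsAisle (U : ObjectProperty D) : Prop extends IsPreaisle U where
  coreflective : U.ι.IsLeftAdjoint

/-- The coaisle `U[1]^{⊥₀} = {Y | Hom(X[1], Y) = 0 for all X in U}` belonging to `U`. For the
`t`-structure `(D^{≤ 0}, D^{≥ 0})` with `D^{≤ 0} = U`, this is `D^{≥ 0}`. -/
def coaisle (U : ObjectProperty D) : ObjectProperty D :=
  fun Y => ∀ ⦃X : D⦄, U X → ∀ f : X⟦(1 : ℤ)⟧ ⟶ Y, f = 0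

end Triangulated

section Abelian

variable {A : Type u} [Category.{v} A] [Abelian A]

/-- A torsion theory `(T, F)` on an abelian category (with `T` and `F` replete): there are no
nonzero maps from `T` to `F`, and each object `X` sits in a short exact sequence
`0 ⟶ T' ⟶ X ⟶ F' ⟶ 0` with `T'` in `T` and `F'` in `F`. -/
structure IsTorsionTheory (T F : ObjectProperty A) : Prop where
  torsion_closedUnderIso : T.IsClosedUnderIsomorphisms
  torsionfree_closedUnderIso : F.IsClosedUnderIsomorphisms
  hom_eq_zero : ∀ ⦃X Y : A⦄, T X → F Y → ∀ f : X ⟶ Y, f = 0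
  exists_shortExact : ∀ X : A, ∃ S : ShortComplex A,
    S.ShortExact ∧ T S.X₁ ∧ S.X₂ = X ∧ F S.X₃

/-- A torsionfree class: the torsionfree part of some torsion theory. -/
def IsTorsionfreeClass (F : ObjectProperty A) : Prop :=
  ∃ T : ObjectProperty A, IsTorsionTheory T F

/-- A full subcategory is nonzero if it has an object which is not a zero object. -/
def IsNonzero (C : ObjectProperty A) : Prop := ∃ X : A, C X ∧ ¬ IsZero X

/-- A co-narrow subcategory (the dual of a narrow subcategory): a full replete subcategory
containing `0` and closed under extensions and kernels. -/
structure IsCoNarrow (C : ObjectProperty A) : Prop where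
  closedUnderIso : C.IsClosedUnderIsomorphisms
  containsZero : C.ContainsZero
  closedUnderExtensions : C.IsClosedUnderExtensions
  closedUnderKernels : C.IsClosedUnderKernels

/-- A co-narrow sequence: `k ↦ C(-k)ᵒᵖ` is a narrow sequence in the opposite category.
A narrow sequence `N` in an abelian category consists of subcategories `N(k) ⊆ N(k + 1)` closed
under extensions and cokernels such that, for every exact sequence `X₀ ⟶ X₁ ⟶ X₂ ⟶ X₃ ⟶ X₄`
with `X₀` in `N(k + 1)`, `X₁` and `X₃` in `N(k)`, and `X₄` in `N(k - 1)`, also `X₂` is in `N(k)`.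
Passing to the opposite category reverses the exact sequence and replaces `k` by `-k`, so that
the last condition keeps its form. -/
structure IsCoNarrowSequence (C : ℤ → ObjectProperty A) : Prop where
  coNarrow : ∀ k, IsCoNarrow (C k)
  antitone : ∀ k, C (k + 1) ≤ C k
  fiveTerm : ∀ (k : ℤ) (S : ComposableArrows A 4), S.Exact →
    C (k + 1) (S.obj 0) → C k (S.obj 1) → C k (S.obj 3) → C (k - 1) (S.obj 4) → C k (S.obj 2)

/-- A reflective co-narrow sequence: each embedding `C(k) ⟶ A` has a left adjoint. -/
structure IsReflectiveCoNarrowSequence (C : ℤ → ObjectProperty A) : Prop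
    extends IsCoNarrowSequence C where
  reflective : ∀ k, (C k).ι.IsRightAdjoint

variable [HasDerivedCategory.{w} A]

/-- The homology functor `H_k = H^{-k}` on the bounded derived category. -/
def homology (k : ℤ) : DerivedCategory.Bounded A ⥤ A :=
  DerivedCategory.Bounded.ι ⋙ DerivedCategory.homologyFunctor A (-k)

/-- `μ(V) = (H_k V)_k`, where `H_k V` is the full replete subcategory of all `H_k X`, `X` in `V`. -/
def mu (V : ObjectProperty (DerivedCategory.Bounded A)) (k : ℤ) : ObjectProperty A :=
  V.map (homology k)

/-- `θ(C) = {X | H_k X is in C(k) for all k}`. -/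
def theta (C : ℤ → ObjectProperty A) : ObjectProperty (DerivedCategory.Bounded A) :=
  fun X => ∀ k : ℤ, C k ((homology k).obj X)

/-- The sequence of subcategories equal to the whole category in degrees `k < n`, to `C` in
degree `k = n`, and to `0` in degrees `k > n`, where `n` is in `ℤ ∪ {±∞}`. -/
def stepSequence (n : WithBot (WithTop ℤ)) (C : ObjectProperty A) (k : ℤ) : ObjectProperty A :=
  fun X => (((k : WithTop ℤ) : WithBot (WithTop ℤ)) < n) ∨
    (((k : WithTop ℤ) : WithBot (WithTop ℤ)) = n ∧ C X) ∨
    (n < ((k : WithTop ℤ) : WithBot (WithTop ℤ)) ∧ IsZero X)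

variable (A) in
/-- The sequences `stepSequence n C` with `n` in `ℤ ∪ {±∞}` and `C` a nonzero torsionfree
class. -/
def torsionfreeStepSequences : Set (ℤ → ObjectProperty A) :=
  {S | ∃ (n : WithBot (WithTop ℤ)) (C : ObjectProperty A),
    IsTorsionfreeClass C ∧ IsNonzero C ∧ S = stepSequence n C}

end Abelian

section Modules

variable {R : Type u} [CommRing R]

/-- The support of a full subcategory: the union of the supports of its objects. -/
def supp (P : ObjectProperty (FGModuleCat.{u} R)) : Set (PrimeSpectrum R) :=
  {p | ∃ M : FGModuleCat.{u} R, P M ∧ p ∈ Module.support R M}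

end Modules

end DedekindAisles

end

/-! Two facts about finitely generated modules over a Dedekind domain drive the classification.

Hereditarity: submodules of free modules are torsion-free, hence projective, so extensions of degree
at least two vanish. The connecting maps of truncation triangles then vanish, and every homology
stalk of a bounded complex is a retract of it (`IsHereditary.exists_retract`). Both halves of a
t-structure are closed under retracts and extensions, so `D^{≥0}` is recovered from its homology
sequence `C(k)` (`ge_eq_theta_mu`).

Nontorsion modules are generators (`exists_surjective_of_isNontorsion`). Truncating `R` placed in
degree `k` gives an exact sequence `H_k X ⟶ R ⟶ H_k Y`, so `D^{≤-1}` or `D^{≥0}` contains a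
nontorsion stalk in degree `k` (`exists_isNontorsion`). In the first case nothing nonzero lies in
`C(k)`. In the second, with nontorsion `L` in `C(k)`, any `M` whose stalk in degree `k - 1` lies in
`D^{≤-1}` satisfies `Hom(M, L) = Ext¹(M, L) = 0`. As `L` generates, `M` is projective without
nonzero maps to `R`, so `M = 0`; hence `D^{≤-1}` lives in degrees at least `k` and `C(j)` is
everything for `j < k`. Thus at most one `C(k)` is neither zero nor everything, and the last nonzero
one is a right orthogonal, hence a torsionfree class by Noetherianity.

Conversely, truncating in one degree and then tilting by a torsion theory realises every step
sequence (`isAisle_stepAisle`).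

For the second bijection, a torsion class is determined by its support: a nonzero torsionfree
quotient contains some `R/p`, and any `M` with `p` in its support maps nontrivially to `R/p`. -/

namespace DedekindAisles

/-! ### Adjoints of full embeddings via universal arrows -/

section Adjoints

variable {C : Type u} [Category.{v} C]

/-- A full subcategory is coreflective if every object has a universal arrow from it. -/
theorem isLeftAdjoint_ι_of_exists {U : ObjectProperty C}
    (h : ∀ X : C, ∃ (A : C) (_ : U A) (i : A ⟶ X),
      ∀ ⦃W : C⦄, U W → ∀ f : W ⟶ X, ∃! g : W ⟶ A, g ≫ i = f) :
    U.ι.IsLeftAdjoint := by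
  choose A hA i hi using h
  let e (W : U.FullSubcategory) (X : C) :
      (U.ι.obj W ⟶ X) ≃ (W ⟶ (⟨A X, hA X⟩ : U.FullSubcategory)) :=
    { toFun := fun f => ObjectProperty.homMk (hi X W.property f).choose
      invFun := fun g => g.hom ≫ i X
      left_inv := fun f => (hi X W.property f).choose_spec.1
      right_inv := fun g => by
        ext
        exact ((hi X W.property (g.hom ≫ i X)).choose_spec.2 _ rfl).symm }
  refine ⟨_, ⟨Adjunction.adjunctionOfEquivRight e ?_⟩⟩
  intro X' X Y f g
  apply (e X' Y).symm.injective
  rw [Equiv.symm_apply_apply]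
  have h := (e X Y).symm_apply_apply g
  change _ = (f.hom ≫ ((e X Y) g).hom) ≫ i Y
  change ((e X Y) g).hom ≫ i Y = g at h
  rw [Category.assoc, h]
  rfl

theorem exists_of_isLeftAdjoint_ι {U : ObjectProperty C} [U.ι.IsLeftAdjoint] (X : C) :
    ∃ (A : C) (_ : U A) (i : A ⟶ X),
      ∀ ⦃W : C⦄, U W → ∀ f : W ⟶ X, ∃! g : W ⟶ A, g ≫ i = f := by
  let adj := Adjunction.ofIsLeftAdjoint U.ι
  refine ⟨(U.ι.rightAdjoint.obj X).obj, (U.ι.rightAdjoint.obj X).property,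
    adj.counit.app X, fun W hW f => ?_⟩
  refine ⟨(adj.homEquiv ⟨W, hW⟩ X f).hom, ?_, fun g hg => ?_⟩
  · have := (adj.homEquiv ⟨W, hW⟩ X).symm_apply_apply f
    rwa [Adjunction.homEquiv_counit] at this
  · have : adj.homEquiv ⟨W, hW⟩ X f = ObjectProperty.homMk g := by
      rw [← Equiv.eq_symm_apply, Adjunction.homEquiv_counit]
      exact hg.symm
    rw [this]
    rfl

/-- A full subcategory is reflective if every object has a universal arrow to it. -/
theorem isRightAdjoint_ι_of_exists {U : ObjectProperty C}
    (h : ∀ X : C, ∃ (A : C) (_ : U A) (p : X ⟶ A),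
      ∀ ⦃W : C⦄, U W → ∀ f : X ⟶ W, ∃! g : A ⟶ W, p ≫ g = f) :
    U.ι.IsRightAdjoint := by
  choose A hA p hp using h
  let e (X : C) (W : U.FullSubcategory) :
      ((⟨A X, hA X⟩ : U.FullSubcategory) ⟶ W) ≃ (X ⟶ U.ι.obj W) :=
    { toFun := fun g => p X ≫ g.hom
      invFun := fun f => ObjectProperty.homMk (hp X W.property f).choose
      left_inv := fun g => by
        ext
        exact ((hp X W.property (p X ≫ g.hom)).choose_spec.2 _ rfl).symm
      right_inv := fun f => (hp X W.property f).choose_spec.1 }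
  refine ⟨_, ⟨Adjunction.adjunctionOfEquivLeft e ?_⟩⟩
  intro X Y Y' g h
  exact (Category.assoc _ _ _).symm

end Adjoints

/-! ### Aisles and t-structures -/

section Triangulated

variable {D : Type u} [Category.{v} D] [Preadditive D] [HasShift D ℤ]
  [∀ n : ℤ, (shiftFunctor D n).Additive]

theorem eq_zero_of_shift {X Y : D} (n : ℤ) (f : X ⟶ Y) (h : f⟦n⟧' = 0) : f = 0 :=
  (shiftFunctor D n).map_injective (by rw [h, Functor.map_zero])

variable [HasZeroObject D] [Pretriangulated D]

theorem distTriang_comp₁₂ {X Y Z : D} {f : X ⟶ Y} {g : Y ⟶ Z} {h : Z ⟶ X⟦(1 : ℤ)⟧}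
    (hT : Triangle.mk f g h ∈ distTriang D) : f ≫ g = 0 :=
  comp_distTriang_mor_zero₁₂ _ hT

theorem distTriang_lift₂ {X Y Z : D} {f : X ⟶ Y} {g : Y ⟶ Z} {h : Z ⟶ X⟦(1 : ℤ)⟧}
    (hT : Triangle.mk f g h ∈ distTriang D) {W : D} (φ : W ⟶ Y) (hφ : φ ≫ g = 0) :
    ∃ ψ : W ⟶ X, ψ ≫ f = φ := by
  obtain ⟨ψ, hψ⟩ := Triangle.coyoneda_exact₂ _ hT φ hφ
  exact ⟨ψ, hψ.symm⟩

theorem distTriang_lift₃ {X Y Z : D} {f : X ⟶ Y} {g : Y ⟶ Z} {h : Z ⟶ X⟦(1 : ℤ)⟧}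
    (hT : Triangle.mk f g h ∈ distTriang D) {W : D} (φ : W ⟶ Z) (hφ : φ ≫ h = 0) :
    ∃ ψ : W ⟶ Y, ψ ≫ g = φ := by
  obtain ⟨ψ, hψ⟩ := Triangle.coyoneda_exact₃ _ hT φ hφ
  exact ⟨ψ, hψ.symm⟩

theorem distTriang_desc₂ {X Y Z : D} {f : X ⟶ Y} {g : Y ⟶ Z} {h : Z ⟶ X⟦(1 : ℤ)⟧}
    (hT : Triangle.mk f g h ∈ distTriang D) {W : D} (φ : Y ⟶ W) (hφ : f ≫ φ = 0) :
    ∃ ψ : Z ⟶ W, g ≫ ψ = φ := by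
  obtain ⟨ψ, hψ⟩ := Triangle.yoneda_exact₂ _ hT φ hφ
  exact ⟨ψ, hψ.symm⟩

/-- After suspension such a map factors through `Z`. This gives uniqueness of factorizations through
coreflections. -/
theorem distTriang_eq_zero_of_comp₁ {X Y Z : D} {f : X ⟶ Y} {g : Y ⟶ Z} {h : Z ⟶ X⟦(1 : ℤ)⟧}
    (hT : Triangle.mk f g h ∈ distTriang D) {W : D} (φ : W ⟶ X) (hφ : φ ≫ f = 0)
    (hW : ∀ ψ : W⟦(1 : ℤ)⟧ ⟶ Z, ψ = 0) : φ = 0 := by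
  apply eq_zero_of_shift 1
  have h0 : φ⟦(1 : ℤ)⟧' ≫ f⟦(1 : ℤ)⟧' = 0 := by
    rw [← Functor.map_comp, hφ, Functor.map_zero]
  obtain ⟨ψ, hψ⟩ := Triangle.coyoneda_exact₁ _ hT (φ⟦(1 : ℤ)⟧') h0
  exact hψ.trans ((congrArg (· ≫ h) (hW ψ)).trans zero_comp)

theorem distTriang_of_iso₃ {X Y Z Z' : D} {f : X ⟶ Y} {g : Y ⟶ Z} {h : Z ⟶ X⟦(1 : ℤ)⟧}
    (hT : Triangle.mk f g h ∈ distTriang D) (e : Z ≅ Z') :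
    Triangle.mk f (g ≫ e.hom) (e.inv ≫ h) ∈ distTriang D := by
  refine isomorphic_distinguished _ hT _
    (Triangle.isoMk _ _ (Iso.refl _) (Iso.refl _) e.symm ?_ ?_ ?_)
  · change f ≫ 𝟙 Y = 𝟙 X ≫ f
    simp
  · change (g ≫ e.hom) ≫ e.inv = 𝟙 Y ≫ g
    simp
  · change (e.inv ≫ h) ≫ (𝟙 X)⟦(1 : ℤ)⟧' = e.inv ≫ h
    simp

/-- The approximation triangle of an aisle. -/
theorem IsAisle.exists_triangle {U : ObjectProperty D} (hU : IsAisle U) (X : D) :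
    ∃ (A B : D) (_ : U A) (_ : U.rightOrthogonal B) (f : A ⟶ X) (g : X ⟶ B)
      (h : B ⟶ A⟦(1 : ℤ)⟧), Triangle.mk f g h ∈ distTriang D := by
  have := hU.coreflective
  obtain ⟨A, hA, i, hi⟩ := exists_of_isLeftAdjoint_ι (U := U) X
  obtain ⟨B, g, h, hT⟩ := distinguished_cocone_triangle i
  refine ⟨A, B, hA, ?_, i, g, h, hT⟩
  intro Y φ hY
  -- `Z` is the extension of `Y` by `A` classified by `φ ≫ h`, so it lies in `U`. Universality of
  -- `i` yields a retraction of `a`, so this extension splits; `φ` then lifts to `X` and factors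
  -- through `i`, which `g` kills.
  obtain ⟨Z, a, b, hT'⟩ := distinguished_cocone_triangle₂ (φ ≫ h)
  have hZ : U Z := hU.closedUnderExtensions _ hT' hA hY
  obtain ⟨c, hc₁⟩ : ∃ c : Z ⟶ X, a ≫ c = i := by
    obtain ⟨c, hc₁, -⟩ := complete_distinguished_triangle_morphism₂ _ _ hT' hT (𝟙 A) φ
      ((congrArg (fun e => (φ ≫ h) ≫ e) (CategoryTheory.Functor.map_id _ _)).trans (Category.comp_id _))
    exact ⟨c, hc₁.trans (Category.id_comp _)⟩
  obtain ⟨r, hr, -⟩ := hi hZ c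
  have har : a ≫ r = 𝟙 A := by
    obtain ⟨_, _, huniq⟩ := hi hA i
    rw [huniq (a ≫ r) (by simp [hr, hc₁]), huniq (𝟙 A) (by simp)]
  have hφ : φ ≫ h = 0 := by
    have h0 : (φ ≫ h) ≫ a⟦(1 : ℤ)⟧' = 0 := comp_distTriang_mor_zero₃₁ _ hT'
    calc φ ≫ h = (φ ≫ h) ≫ (a ≫ r)⟦(1 : ℤ)⟧' := by rw [har]; simp
      _ = 0 := by rw [Functor.map_comp, ← Category.assoc, h0, zero_comp]
  obtain ⟨ψ, hψ⟩ := distTriang_lift₃ hT φ hφ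
  obtain ⟨ρ, hρ, -⟩ := hi hY ψ
  rw [← hψ, ← hρ, Category.assoc, distTriang_comp₁₂ hT, comp_zero]

variable (U : ObjectProperty D)

/-- The `t`-structure defined by a suspended subcategory with approximation triangles. -/
def tStructureOfTriangles (hiso : U.IsClosedUnderIsomorphisms)
    (hsusp : ∀ X : D, U X → U (X⟦(1 : ℤ)⟧))
    (htri : ∀ X : D, ∃ (A B : D) (_ : U A) (_ : U.rightOrthogonal B) (f : A ⟶ X) (g : X ⟶ B)
      (h : B ⟶ A⟦(1 : ℤ)⟧), Triangle.mk f g h ∈ distTriang D) : TStructure D where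
  le n X := U (X⟦n⟧)
  -- The right orthogonal of `le 0` is `ge 1`, whence the shift by `n - 1`.
  ge n X := U.rightOrthogonal (X⟦n - 1⟧)
  le_isClosedUnderIsomorphisms n := ⟨fun e h => U.prop_of_iso ((shiftFunctor D n).mapIso e) h⟩
  ge_isClosedUnderIsomorphisms n :=
    ⟨fun e h => U.rightOrthogonal.prop_of_iso ((shiftFunctor D (n - 1)).mapIso e) h⟩
  le_shift n a n' h X hX := U.prop_of_iso ((shiftFunctorAdd' D a n' n h).app X) hX
  ge_shift n a n' h X hX := U.rightOrthogonal.prop_of_iso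
    ((shiftFunctorAdd' D a (n' - 1) (n - 1) (by lia)).app X) hX
  zero' X Y f hX hY := by
    have hY' := U.rightOrthogonal.prop_of_iso ((shiftFunctorZero D ℤ).app Y) hY
    exact hY' f (U.prop_of_iso ((shiftFunctorZero D ℤ).app X) hX)
  le_zero_le X hX := hsusp X (U.prop_of_iso ((shiftFunctorZero D ℤ).app X) hX)
  ge_one_le X hX := by
    have hX' := U.rightOrthogonal.prop_of_iso ((shiftFunctorZero D ℤ).app X) hX
    intro W f hW
    apply eq_zero_of_shift 1
    let e := (shiftFunctorCompIsoId D (0 - 1 : ℤ) 1 (by lia)).app X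
    have h : f⟦(1 : ℤ)⟧' ≫ e.hom = 0 := hX' _ (hsusp W hW)
    calc f⟦(1 : ℤ)⟧' = (f⟦(1 : ℤ)⟧' ≫ e.hom) ≫ e.inv := by
          rw [Category.assoc, e.hom_inv_id]
          exact (Category.comp_id _).symm
      _ = 0 := by rw [h, zero_comp]
  exists_triangle_zero_one X := by
    obtain ⟨A, B, hA, hB, f, g, h, hT⟩ := htri X
    exact ⟨A, B, U.prop_of_iso ((shiftFunctorZero D ℤ).symm.app A) hA,
      U.rightOrthogonal.prop_of_iso ((shiftFunctorZero D ℤ).symm.app B) hB, f, g, h, hT⟩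

theorem tStructureOfTriangles_le_zero (hiso : U.IsClosedUnderIsomorphisms)
    (hsusp : ∀ X : D, U X → U (X⟦(1 : ℤ)⟧))
    (htri : ∀ X : D, ∃ (A B : D) (_ : U A) (_ : U.rightOrthogonal B) (f : A ⟶ X) (g : X ⟶ B)
      (h : B ⟶ A⟦(1 : ℤ)⟧), Triangle.mk f g h ∈ distTriang D) :
    (tStructureOfTriangles U hiso hsusp htri).le 0 = U := by
  ext X
  exact U.prop_iff_of_iso ((shiftFunctorZero D ℤ).app X)

theorem tStructure_ext {t t' : TStructure D} (h : t.le 0 = t'.le 0) : t = t' := by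
  have hle : t.le = t'.le := by
    ext n X
    rw [← t.shift_le n 0 n (by lia), ← t'.shift_le n 0 n (by lia), h]
  have hge : t.ge = t'.ge := by
    ext n X
    rw [t.ge_iff_isGE, t'.ge_iff_isGE, t.isGE_iff_orthogonal (n - 1) n (by lia),
      t'.isGE_iff_orthogonal (n - 1) n (by lia)]
    simp only [← TStructure.le_iff_isLE, hle]
  cases t
  cases t'
  cases hle
  cases hge
  rfl

theorem tStructure_ext_ge {t t' : TStructure D} (h : t.ge 0 = t'.ge 0) : t = t' := by
  have h1 : t.ge 1 = t'.ge 1 := by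
    rw [← t.shift_ge 1 0 1 (by lia), ← t'.shift_ge 1 0 1 (by lia), h]
  refine tStructure_ext ?_
  ext X
  rw [t.le_iff_isLE, t'.le_iff_isLE, t.isLE_iff_orthogonal 0 1 (by lia),
    t'.isLE_iff_orthogonal 0 1 (by lia)]
  simp only [← TStructure.ge_iff_isGE, h1]

/-- `ge 0` is the right orthogonal of `le (-1)`, which is the suspension of `le 0`. -/
theorem ge_zero_eq_coaisle (t : TStructure D) : t.ge 0 = coaisle (t.le 0) := by
  ext Y
  constructor
  · intro hY X hX f
    exact t.zero_of_isLE_of_isGE f (-1) 0 (by lia) ⟨t.le_shift 0 1 (-1) (by lia) X hX⟩ ⟨hY⟩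
  · intro hY
    rw [t.ge_iff_isGE, t.isGE_iff_orthogonal (-1) 0 (by lia)]
    intro X f hX
    have h := hY (t.le_shift (-1) (-1) 0 (by lia) X hX.le)
      (((shiftFunctorCompIsoId D (-1 : ℤ) 1 (by lia)).app X).hom ≫ f)
    rwa [Preadditive.IsIso.comp_left_eq_zero] at h

theorem isAisle_of_tStructure (t : TStructure D) : IsAisle (t.le 0) where
  closedUnderIso := inferInstance
  closedUnderSuspension X hX := t.le_monotone (by lia) _ (t.le_shift 0 1 (-1) (by lia) X hX)
  closedUnderExtensions T hT h₁ h₃ := by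
    rw [t.le_iff_isLE, t.isLE_iff_orthogonal 0 1 (by lia)] at *
    intro Y f hY
    obtain ⟨g, rfl⟩ := Triangle.yoneda_exact₂ T hT f (h₁ _ _ hY)
    rw [h₃ _ g hY, comp_zero]
  coreflective := by
    apply isLeftAdjoint_ι_of_exists
    intro X
    obtain ⟨A, B, hA, hB, i, g, h, hT⟩ := t.exists_triangle_zero_one X
    refine ⟨A, hA, i, fun W hW f => ?_⟩
    obtain ⟨φ, hφ⟩ := distTriang_lift₂ hT f (t.zero' _ hW hB)
    refine ⟨φ, hφ, fun ψ hψ => sub_eq_zero.1 ?_⟩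
    refine distTriang_eq_zero_of_comp₁ hT _ ?_ fun χ => ?_
    · rw [Preadditive.sub_comp, hφ, sub_eq_zero]
      exact hψ
    · exact t.zero_of_isLE_of_isGE χ (-1) 1 (by lia) ⟨t.le_shift 0 1 (-1) (by lia) W hW⟩ ⟨hB⟩

/-- An aisle is the left part of a `t`-structure. -/
theorem IsAisle.exists_tStructure {U : ObjectProperty D} (hU : IsAisle U) :
    ∃ t : TStructure D, t.le 0 = U :=
  ⟨_, tStructureOfTriangles_le_zero U hU.closedUnderIso hU.closedUnderSuspension
    hU.exists_triangle⟩

end Triangulated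

/-! ### Stalks, homology and truncation in the bounded derived category -/

section BoundedDerivedCategory

variable {A : Type u} [Category.{v} A] [Abelian A] [HasDerivedCategory.{w} A]

/-- The stalk complexes concentrated in homological degree `k`. -/
noncomputable def stalk (k : ℤ) : A ⥤ DerivedCategory.Bounded A :=
  ObjectProperty.lift _ (DerivedCategory.singleFunctor A (-k))
    fun _ => ⟨⟨-k, inferInstance⟩, ⟨-k, inferInstance⟩⟩

instance (k : ℤ) : (stalk (A := A) k).Additive where
  map_add {X Y f g} := by
    ext
    exact (DerivedCategory.singleFunctor A (-k)).map_add

instance (k : ℤ) : (stalk (A := A) k).Full where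
  map_surjective f := by
    obtain ⟨g, hg⟩ := (DerivedCategory.singleFunctor A (-k)).map_surjective f.hom
    exact ⟨g, ObjectProperty.hom_ext _ hg⟩

instance (k : ℤ) : (stalk (A := A) k).Faithful where
  map_injective {M N} _ _ h := (DerivedCategory.singleFunctor A (-k)).map_injective
    (congrArg (fun φ : (stalk k).obj M ⟶ (stalk k).obj N => φ.hom) h)

instance (k : ℤ) : (homology (A := A) k).Additive := by
  unfold homology
  infer_instance

/-- The homology of a stalk complex. -/
noncomputable def stalkHomologyIso (k : ℤ) (M : A) : (homology k).obj ((stalk k).obj M) ≅ M :=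
  (DerivedCategory.singleFunctorCompHomologyFunctorIso A (-k)).app M

/-- Shifting stalk complexes. -/
noncomputable def stalkShiftIso (k n l : ℤ) (h : k + n = l) (M : A) :
    ((stalk k).obj M)⟦n⟧ ≅ (stalk l).obj M :=
  (ObjectProperty.fullyFaithfulι _).preimageIso
    (((DerivedCategory.Bounded.ι (C := A)).commShiftIso n).app _ ≪≫
      ((DerivedCategory.singleFunctors A).shiftIso n (-l) (-k) (by lia)).app M)

/-- The homology of a suspension. -/
noncomputable def homologyShiftIso (k l : ℤ) (h : k + 1 = l) (X : DerivedCategory.Bounded A) :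
    (homology l).obj (X⟦(1 : ℤ)⟧) ≅ (homology k).obj X :=
  (DerivedCategory.homologyFunctor A (-l)).mapIso
      (((DerivedCategory.Bounded.ι (C := A)).commShiftIso (1 : ℤ)).app X) ≪≫
    ((DerivedCategory.homologyFunctor A 0).shiftIso 1 (-l) (-k) (by lia)).app X.obj

/-- Morphisms between stalk complexes are extensions. -/
noncomputable def stalkHomEquiv [HasExt.{w} A] (k l : ℤ) (n : ℕ) (h : k + n = l) (M N : A) :
    ((stalk k).obj M ⟶ (stalk l).obj N) ≃ Abelian.Ext.{w} M N n :=
  (ObjectProperty.fullyFaithfulι _).homEquiv.trans <|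
    (Functor.FullyFaithful.ofFullyFaithful (shiftFunctor (DerivedCategory A) (-k))).homEquiv.trans <|
    (Iso.homCongr (((DerivedCategory.singleFunctors A).shiftIso (-k) 0 (-k) (by lia)).app M)
      (((DerivedCategory.singleFunctors A).shiftIso (-k) (-n) (-l) (by lia)).app N ≪≫
      (((DerivedCategory.singleFunctors A).shiftIso n (-n) 0 (by lia)).app N).symm)).trans
    Abelian.Ext.homEquiv.symm

/-- The objects whose homology vanishes in degrees below `k`. -/
def geHomology (k : ℤ) : ObjectProperty (DerivedCategory.Bounded A) :=
  fun X => ∀ j < k, IsZero ((homology j).obj X)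

/-- The objects whose homology vanishes in degrees above `k`. -/
def leHomology (k : ℤ) : ObjectProperty (DerivedCategory.Bounded A) :=
  fun X => ∀ j, k < j → IsZero ((homology j).obj X)

theorem geHomology_iff (k : ℤ) (X : DerivedCategory.Bounded A) :
    geHomology k X ↔ (DerivedCategory.TStructure.t (C := A)).onBounded.IsLE X (-k) := by
  refine Iff.trans ?_ ((ObjectProperty.tStructure_isLE_iff _ _ X (-k)).trans
    (DerivedCategory.isLE_iff X.obj (-k))).symm
  constructor
  · intro h i hi
    have := h (-i) (by lia)
    rwa [homology, neg_neg] at this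
  · intro h j hj
    exact h (-j) (by lia)

theorem leHomology_iff (k : ℤ) (X : DerivedCategory.Bounded A) :
    leHomology k X ↔ (DerivedCategory.TStructure.t (C := A)).onBounded.IsGE X (-k) := by
  refine Iff.trans ?_ ((ObjectProperty.tStructure_isGE_iff _ _ X (-k)).trans
    (DerivedCategory.isGE_iff X.obj (-k))).symm
  constructor
  · intro h i hi
    have := h (-i) (by lia)
    rwa [homology, neg_neg] at this
  · intro h j hj
    exact h (-j) (by lia)

theorem exists_leHomology (X : DerivedCategory.Bounded A) : ∃ k, leHomology k X := by
  obtain ⟨n, hn⟩ := X.property.1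
  refine ⟨-n, (leHomology_iff _ _).2 ?_⟩
  rw [neg_neg, ObjectProperty.tStructure_isGE_iff]
  exact hn

theorem exists_geHomology (X : DerivedCategory.Bounded A) : ∃ k, geHomology k X := by
  obtain ⟨n, hn⟩ := X.property.2
  refine ⟨-n, (geHomology_iff _ _).2 ?_⟩
  rw [neg_neg, ObjectProperty.tStructure_isLE_iff]
  exact hn

theorem geHomology_stalk (k : ℤ) (M : A) : geHomology k ((stalk k).obj M) := by
  rw [geHomology_iff, ObjectProperty.tStructure_isLE_iff]
  exact inferInstanceAs (((DerivedCategory.singleFunctor A (-k)).obj M).IsLE (-k))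

theorem leHomology_stalk (k : ℤ) (M : A) : leHomology k ((stalk k).obj M) := by
  rw [leHomology_iff, ObjectProperty.tStructure_isGE_iff]
  exact inferInstanceAs (((DerivedCategory.singleFunctor A (-k)).obj M).IsGE (-k))

theorem eq_zero_of_geHomology_of_leHomology {X Y : DerivedCategory.Bounded A} (f : X ⟶ Y)
    {k l : ℤ} (h : l < k) (hX : geHomology k X) (hY : leHomology l Y) : f = 0 :=
  TStructure.zero_of_isLE_of_isGE _ f (-k) (-l) (by lia)
    ((geHomology_iff _ _).1 hX) ((leHomology_iff _ _).1 hY)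

theorem exists_truncation (X : DerivedCategory.Bounded A) (k : ℤ) :
    ∃ (P Q : DerivedCategory.Bounded A) (_ : geHomology k P) (_ : leHomology (k - 1) Q)
      (f : P ⟶ X) (g : X ⟶ Q) (h : Q ⟶ P⟦(1 : ℤ)⟧),
      Triangle.mk f g h ∈ distTriang (DerivedCategory.Bounded A) := by
  obtain ⟨P, Q, hP, hQ, f, g, h, hT⟩ :=
    (DerivedCategory.TStructure.t (C := A)).onBounded.exists_triangle X (-k) (-(k - 1)) (by lia)
  exact ⟨P, Q, (geHomology_iff _ _).2 ⟨hP⟩, (leHomology_iff _ _).2 ⟨hQ⟩, f, g, h, hT⟩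

theorem nonempty_iso_stalk {X : DerivedCategory.Bounded A} {k : ℤ} (h : geHomology k X)
    (h' : leHomology k X) : Nonempty (X ≅ (stalk k).obj ((homology k).obj X)) := by
  rw [geHomology_iff, ObjectProperty.tStructure_isLE_iff] at h
  rw [leHomology_iff, ObjectProperty.tStructure_isGE_iff] at h'
  obtain ⟨M, ⟨e⟩⟩ := DerivedCategory.exists_iso_singleFunctor_obj_of_isGE_of_isLE X.obj (-k)
  have e' : X ≅ (stalk k).obj M := (ObjectProperty.fullyFaithfulι _).preimageIso e
  exact ⟨e' ≪≫ (stalk k).mapIso ((stalkHomologyIso k M).symm ≪≫ (homology k).mapIso e'.symm)⟩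

section HomologySequence

variable {X Y Z : DerivedCategory.Bounded A} {f : X ⟶ Y} {g : Y ⟶ Z} {h : Z ⟶ X⟦(1 : ℤ)⟧}
  (hT : Triangle.mk f g h ∈ distTriang (DerivedCategory.Bounded A))

include hT

theorem homology_comp_eq_zero (k : ℤ) : (homology k).map f ≫ (homology k).map g = 0 := by
  rw [← Functor.map_comp, distTriang_comp₁₂ hT, Functor.map_zero]

theorem homology_exact (k : ℤ) : (ShortComplex.mk _ _ (homology_comp_eq_zero hT k)).Exact :=
  DerivedCategory.HomologySequence.exact₂ _
    ((DerivedCategory.Bounded.ι (C := A)).map_distinguished _ hT) (-k)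

/-- Both sides say that the connecting map `H_{k+1} Z ⟶ H_k X` vanishes. -/
theorem homology_mono_iff_epi (k : ℤ) :
    Mono ((homology k).map f) ↔ Epi ((homology (k + 1)).map g) := by
  have hT' := (DerivedCategory.Bounded.ι (C := A)).map_distinguished _ hT
  exact (DerivedCategory.HomologySequence.mono_homologyMap_mor₁_iff _ hT' (-(k + 1)) (-k)
    (by lia)).trans (DerivedCategory.HomologySequence.epi_homologyMap_mor₂_iff _ hT' (-(k + 1)) (-k)
    (by lia)).symm

theorem homology_epi_iff (k : ℤ) : Epi ((homology k).map f) ↔ (homology k).map g = 0 :=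
  DerivedCategory.HomologySequence.epi_homologyMap_mor₁_iff _
    ((DerivedCategory.Bounded.ι (C := A)).map_distinguished _ hT) (-k)

theorem homology_mono_iff (k : ℤ) : Mono ((homology k).map g) ↔ (homology k).map f = 0 :=
  DerivedCategory.HomologySequence.mono_homologyMap_mor₂_iff _
    ((DerivedCategory.Bounded.ι (C := A)).map_distinguished _ hT) (-k)

theorem homology_mono_of_isZero (k : ℤ) (hZ : IsZero ((homology (k + 1)).obj Z)) :
    Mono ((homology k).map f) :=
  (homology_mono_iff_epi hT k).2 ⟨fun _ _ _ => hZ.eq_of_src _ _⟩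

theorem homology_epi_of_isZero (k : ℤ) (hX : IsZero ((homology k).obj X)) :
    Epi ((homology (k + 1)).map g) :=
  (homology_mono_iff_epi hT k).1 ⟨fun _ _ _ => hX.eq_of_tgt _ _⟩

theorem homology_isIso₁ (k : ℤ) (hZ : IsZero ((homology k).obj Z))
    (hZ' : IsZero ((homology (k + 1)).obj Z)) : IsIso ((homology k).map f) := by
  have := homology_mono_of_isZero hT k hZ'
  have := (homology_epi_iff hT k).2 (hZ.eq_of_tgt _ _)
  exact isIso_of_mono_of_epi _

theorem homology_isIso₂ (k : ℤ) (hX : IsZero ((homology k).obj X))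
    (hX' : IsZero ((homology (k - 1)).obj X)) : IsIso ((homology k).map g) := by
  have h := homology_epi_of_isZero hT (k - 1) hX'
  rw [sub_add_cancel] at h
  have := (homology_mono_iff hT k).2 (hX.eq_of_src _ _)
  exact isIso_of_mono_of_epi _

end HomologySequence

/-- Dévissage: an extension closed subcategory contains the objects all of whose homology
stalks it contains. -/
theorem prop_of_prop_stalk (W : ObjectProperty (DerivedCategory.Bounded A))
    [W.IsClosedUnderIsomorphisms] [W.ContainsZero]
    (hext : ∀ T : Triangle (DerivedCategory.Bounded A), T ∈ distTriang _ →
      W T.obj₁ → W T.obj₃ → W T.obj₂)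
    (X : DerivedCategory.Bounded A) (h : ∀ k, W ((stalk k).obj ((homology k).obj X))) : W X := by
  obtain ⟨a, ha⟩ := exists_geHomology X
  -- Induction on the length `n` of the interval `a, …, a + n - 1` of degrees that may carry
  -- homology; each step splits off the top stalk.
  suffices H : ∀ (n : ℕ) (X : DerivedCategory.Bounded A), geHomology a X →
      leHomology (a + n - 1) X → (∀ k, W ((stalk k).obj ((homology k).obj X))) → W X by
    obtain ⟨b, hb⟩ := exists_leHomology X
    exact H (b + 1 - a).toNat X ha (fun j hj => hb j (by lia)) h
  intro n
  induction n with
  | zero =>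
    intro X h₁ h₂ _
    refine W.prop_of_isZero ?_
    rw [IsZero.iff_id_eq_zero]
    exact eq_zero_of_geHomology_of_leHomology _ (by simp) h₁ h₂
  | succ n ih =>
    intro X h₁ h₂ h
    obtain ⟨P, Q, hP, hQ, f, g, δ, hT⟩ := exists_truncation X (a + n)
    have e₁ (j : ℤ) (hj : a + n ≤ j) : Nonempty ((homology j).obj P ≅ (homology j).obj X) := by
      have := homology_isIso₁ hT j (hQ _ (by lia)) (hQ _ (by lia))
      exact ⟨asIso ((homology j).map f)⟩
    have e₂ (j : ℤ) (hj : j < a + n) : Nonempty ((homology j).obj X ≅ (homology j).obj Q) := by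
      have := homology_isIso₂ hT j (hP _ (by lia)) (hP _ (by lia))
      exact ⟨asIso ((homology j).map g)⟩
    refine hext _ hT ?_ (ih Q ?_ hQ ?_)
    · obtain ⟨e⟩ := nonempty_iso_stalk hP fun j hj => by
        obtain ⟨e⟩ := e₁ j hj.le
        exact (h₂ j (by push_cast; lia)).of_iso e
      obtain ⟨e'⟩ := e₁ (a + n) le_rfl
      exact W.prop_of_iso ((stalk _).mapIso e'.symm ≪≫ e.symm) (h _)
    · intro j hj
      by_cases hj' : j < a + n
      · obtain ⟨e⟩ := e₂ j hj'
        exact (h₁ j hj).of_iso e.symm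
      · exact hQ j (by lia)
    · intro k
      by_cases hk : k < a + n
      · obtain ⟨e⟩ := e₂ k hk
        exact W.prop_of_iso ((stalk k).mapIso e) (h k)
      · exact W.prop_of_isZero ((stalk k).map_isZero (hQ k (by lia)))

/-- The morphism from an object to its lowest homology stalk. -/
theorem exists_bottom_triangle {X : DerivedCategory.Bounded A} {k : ℤ} (hX : geHomology k X) :
    ∃ (P : DerivedCategory.Bounded A) (_ : geHomology (k + 1) P) (f : P ⟶ X)
      (g : X ⟶ (stalk k).obj ((homology k).obj X)) (h : _ ⟶ P⟦(1 : ℤ)⟧),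
      Triangle.mk f g h ∈ distTriang (DerivedCategory.Bounded A) := by
  obtain ⟨P, Q, hP, hQ, f, g, h, hT⟩ := exists_truncation X (k + 1)
  rw [add_sub_cancel_right] at hQ
  have e (j : ℤ) (hj : j ≤ k) : Nonempty ((homology j).obj X ≅ (homology j).obj Q) := by
    have := homology_isIso₂ hT j (hP _ (by lia)) (hP _ (by lia))
    exact ⟨asIso ((homology j).map g)⟩
  obtain ⟨e₁⟩ := nonempty_iso_stalk (fun j hj => by
    obtain ⟨e'⟩ := e j hj.le
    exact (hX j hj).of_iso e'.symm) hQ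
  obtain ⟨e₂⟩ := e k le_rfl
  let e₃ := e₁ ≪≫ (stalk k).mapIso e₂.symm
  exact ⟨P, hP, f, g ≫ e₃.hom, e₃.inv ≫ h, distTriang_of_iso₃ hT e₃⟩

end BoundedDerivedCategory

/-! ### Split triangles and closure properties of t-structures -/

section Retracts

variable {D : Type u} [Category.{v} D] [Preadditive D] [HasZeroObject D] [HasShift D ℤ]
  [∀ n : ℤ, (shiftFunctor D n).Additive] [Pretriangulated D]

theorem distTriang_exists_retraction {X Y Z : D} {f : X ⟶ Y} {g : Y ⟶ Z}
    {h : Z ⟶ X⟦(1 : ℤ)⟧} (hT : Triangle.mk f g h ∈ distTriang D) (hh : h = 0) :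
    ∃ r : Y ⟶ X, f ≫ r = 𝟙 X := by
  obtain ⟨e, he, -⟩ := exists_iso_binaryBiproduct_of_distTriang _ hT hh
  exact ⟨e.hom ≫ biprod.fst,
    (Category.assoc _ _ _).symm.trans ((congrArg (· ≫ biprod.fst) he).trans biprod.inl_fst)⟩

theorem distTriang_exists_section {X Y Z : D} {f : X ⟶ Y} {g : Y ⟶ Z}
    {h : Z ⟶ X⟦(1 : ℤ)⟧} (hT : Triangle.mk f g h ∈ distTriang D) (hh : h = 0) :
    ∃ s : Z ⟶ Y, s ≫ g = 𝟙 Z :=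
  distTriang_lift₃ hT (𝟙 Z) (by rw [hh, comp_zero])

theorem tStructure_ge_of_retract (t : TStructure D) {n : ℤ} {X Y : D} (i : Y ⟶ X) (p : X ⟶ Y)
    (h : i ≫ p = 𝟙 Y) (hX : t.ge n X) : t.ge n Y := by
  rw [t.ge_iff_isGE, t.isGE_iff_orthogonal (n - 1) n (by lia)] at *
  intro W f hW
  rw [← Category.comp_id f, ← h, ← Category.assoc, hX _ (f ≫ i) hW, zero_comp]

theorem tStructure_le_of_retract (t : TStructure D) {n : ℤ} {X Y : D} (i : Y ⟶ X) (p : X ⟶ Y)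
    (h : i ≫ p = 𝟙 Y) (hX : t.le n X) : t.le n Y := by
  rw [t.le_iff_isLE, t.isLE_iff_orthogonal n (n + 1) (by lia)] at *
  intro W f hW
  rw [← Category.id_comp f, ← h, Category.assoc, hX _ (p ≫ f) hW, comp_zero]

theorem tStructure_ge_ext₂ (t : TStructure D) (n : ℤ) (T : Triangle D) (hT : T ∈ distTriang D)
    (h₁ : t.ge n T.obj₁) (h₃ : t.ge n T.obj₃) : t.ge n T.obj₂ := by
  rw [t.ge_iff_isGE, t.isGE_iff_orthogonal (n - 1) n (by lia)] at *
  intro W f hW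
  obtain ⟨g, rfl⟩ := Triangle.coyoneda_exact₂ T hT f (h₃ _ _ hW)
  rw [h₁ _ g hW, zero_comp]

theorem tStructure_ge_of_isZero (t : TStructure D) (n : ℤ) {X : D} (hX : IsZero X) :
    t.ge n X := by
  rw [t.ge_iff_isGE, t.isGE_iff_orthogonal (n - 1) n (by lia)]
  exact fun _ _ _ => hX.eq_of_tgt _ _

instance (t : TStructure D) (n : ℤ) : (t.ge n).ContainsZero :=
  ⟨⟨_, isZero_zero D, tStructure_ge_of_isZero t n (isZero_zero D)⟩⟩

end Retracts

/-! ### Hereditary categories: homology stalks are retracts -/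

section Hereditary

variable {A : Type u} [Category.{v} A] [Abelian A] [HasDerivedCategory.{w} A]

variable (A) in
/-- An abelian category is hereditary if its extension groups of degree at least two vanish. -/
def IsHereditary : Prop :=
  ∀ (M N : A) (k l : ℤ), k + 2 ≤ l → ∀ f : (stalk k).obj M ⟶ (stalk l).obj N, f = 0

theorem isHereditary_of_ext [HasExt.{w} A]
    (h : ∀ (M N : A) (n : ℕ), 2 ≤ n → Subsingleton (Abelian.Ext.{w} M N n)) :
    IsHereditary A := by
  intro M N k l hkl f
  have := h M N (l - k).toNat (by lia)
  have := (stalkHomEquiv k l (l - k).toNat (by lia) M N).subsingleton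
  exact Subsingleton.elim _ _

/-- Dévissage in each variable reduces to maps between stalks. -/
theorem IsHereditary.eq_zero (hA : IsHereditary A) {X Y : DerivedCategory.Bounded A} {k l : ℤ}
    (hkl : k + 2 ≤ l) (hX : leHomology k X) (hY : geHomology l Y) (f : X ⟶ Y) : f = 0 := by
  suffices H : ∀ j ≤ k, ∀ (M : A), ∀ φ : (stalk j).obj M ⟶ Y, φ = 0 by
    refine prop_of_prop_stalk (ObjectProperty.leftOrthogonal (fun Z => Z = Y)) ?_ X ?_ f rfl
    · exact fun T hT h₁ h₃ => ObjectProperty.ext_of_isTriangulatedClosed₂ _ T hT h₁ h₃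
    · rintro j _ φ rfl
      by_cases hj : j ≤ k
      · exact H j hj _ φ
      · exact ((stalk j).map_isZero (hX j (by lia))).eq_of_src _ _
  intro j hj M φ
  refine prop_of_prop_stalk (ObjectProperty.rightOrthogonal (fun Z => Z = (stalk j).obj M))
    ?_ Y ?_ φ rfl
  · exact fun T hT h₁ h₃ => ObjectProperty.ext_of_isTriangulatedClosed₂ _ T hT h₁ h₃
  · rintro i _ ψ rfl
    by_cases hi : i < l
    · exact ((stalk i).map_isZero (hY i hi)).eq_of_tgt _ _
    · exact hA _ _ _ _ (by lia) ψ

/-- Truncation at `k` and then at `k + 1` gives two triangles. Suspension raises the degrees of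
their first terms, so both connecting maps jump by at least two degrees and vanish: `H_k` is a
retract of the truncation, which is a retract of `X`. -/
theorem IsHereditary.exists_retract (hA : IsHereditary A) (X : DerivedCategory.Bounded A)
    (k : ℤ) : ∃ (i : (stalk k).obj ((homology k).obj X) ⟶ X)
      (p : X ⟶ (stalk k).obj ((homology k).obj X)), i ≫ p = 𝟙 _ := by
  obtain ⟨P, Q, hP, hQ, f, g, h, hT⟩ := exists_truncation X k
  obtain ⟨r, hr⟩ := distTriang_exists_retraction hT
    (hA.eq_zero (l := k + 1) (by lia) hQ (fun j hj => (hP (j - 1) (by lia)).of_iso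
      (homologyShiftIso (j - 1) j (by lia) P)) h)
  obtain ⟨P', hP', f', g', h', hT'⟩ := exists_bottom_triangle hP
  obtain ⟨s, hs⟩ := distTriang_exists_section hT'
    (hA.eq_zero (l := k + 2) (by lia) (leHomology_stalk _ _)
      (fun j hj => (hP' (j - 1) (by lia)).of_iso (homologyShiftIso (j - 1) j (by lia) P')) h')
  have := homology_isIso₁ hT k (hQ _ (by lia)) (hQ _ (by lia))
  let e := (stalk k).mapIso (asIso ((homology k).map f))
  refine ⟨e.inv ≫ s ≫ f, r ≫ g' ≫ e.hom, ?_⟩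
  calc (e.inv ≫ s ≫ f) ≫ r ≫ g' ≫ e.hom = e.inv ≫ s ≫ (f ≫ r) ≫ g' ≫ e.hom := by
        simp only [Category.assoc]
    _ = e.inv ≫ (s ≫ g') ≫ e.hom := by rw [hr, Category.id_comp, Category.assoc]
    _ = 𝟙 _ := by rw [hs, Category.id_comp, e.inv_hom_id]

variable (hA : IsHereditary A) (t : TStructure (DerivedCategory.Bounded A))

include hA

theorem tStructure_ge_stalk {n : ℤ} {X : DerivedCategory.Bounded A} (hX : t.ge n X) (k : ℤ) :
    t.ge n ((stalk k).obj ((homology k).obj X)) := by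
  obtain ⟨i, p, h⟩ := hA.exists_retract X k
  exact tStructure_ge_of_retract t i p h hX

theorem tStructure_le_stalk {n : ℤ} {X : DerivedCategory.Bounded A} (hX : t.le n X) (k : ℤ) :
    t.le n ((stalk k).obj ((homology k).obj X)) := by
  obtain ⟨i, p, h⟩ := hA.exists_retract X k
  exact tStructure_le_of_retract t i p h hX

theorem mu_ge_iff (n k : ℤ) (M : A) : mu (t.ge n) k M ↔ t.ge n ((stalk k).obj M) := by
  constructor
  · rintro ⟨X, hX, ⟨e⟩⟩
    exact (t.ge n).prop_of_iso ((stalk k).mapIso e) (tStructure_ge_stalk hA t hX k)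
  · exact fun h => ⟨_, h, ⟨stalkHomologyIso k M⟩⟩

/-- An object is built from its homology stalks by extensions, and these stalks lie in `ge n`
because it is closed under retracts. -/
theorem ge_eq_theta_mu (n : ℤ) : t.ge n = theta (mu (t.ge n)) := by
  ext X
  constructor
  · exact fun hX k => ⟨X, hX, ⟨Iso.refl _⟩⟩
  · intro hX
    exact prop_of_prop_stalk _ (tStructure_ge_ext₂ t n) X
      fun k => (mu_ge_iff hA t n k _).1 (hX k)

end Hereditary

/-! ### Supports, nontorsion modules and generators -/

section Noetherian

variable {R : Type u} [CommRing R]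

/-- A module is nontorsion if some element has zero annihilator. -/
def IsNontorsion (R : Type u) [CommRing R] (M : Type u) [AddCommGroup M] [Module R M] : Prop :=
  ∃ x : M, ∀ r : R, r • x = 0 → r = 0

/-- If all maps vanish, some element of the annihilator of `M` is regular on `R/p`. That element
lies in `p`, so it acts as zero there. -/
theorem exists_linearMap_ne_zero_of_mem_support [IsNoetherianRing R] {M : Type u}
    [AddCommGroup M] [Module R M] [Module.Finite R M] {p : PrimeSpectrum R}
    (hp : p ∈ Module.support R M) : ∃ f : M →ₗ[R] R ⧸ p.asIdeal, f ≠ 0 := by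
  by_contra! h
  have : Subsingleton (M →ₗ[R] R ⧸ p.asIdeal) := ⟨fun f g => by rw [h f, h g]⟩
  obtain ⟨r, hr, hreg⟩ := IsSMulRegular.subsingleton_linearMap_iff.1 this
  have hrp : r ∈ p.asIdeal := Module.mem_support_iff_of_finite.1 hp hr
  have h1 : (1 : R ⧸ p.asIdeal) = 0 := hreg (by
    change r • (1 : R ⧸ p.asIdeal) = r • 0
    rw [smul_zero, ← map_one (Ideal.Quotient.mk p.asIdeal)]
    exact Ideal.Quotient.eq_zero_iff_mem.2 (by simpa using hrp))
  exact one_ne_zero h1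

theorem mem_support_of_le_annihilator {M : Type u} [AddCommGroup M] [Module R M]
    {p : PrimeSpectrum R} {x : M} (hx : ∀ r : R, r • x = 0 → r ∈ p.asIdeal) :
    p ∈ Module.support R M := by
  rw [Module.mem_support_iff_exists_annihilator]
  refine ⟨x, fun r hr => hx r ?_⟩
  rwa [Submodule.mem_annihilator_span_singleton] at hr

end Noetherian

section Dedekind

variable {R : Type u} [CommRing R] [IsDedekindDomain R]

theorem projective_of_isTorsionFree {M : Type u} [AddCommGroup M] [Module R M] [Module.Finite R M]
    [Module.IsTorsionFree R M] : Module.Projective R M := by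
  have : Module.Flat R M := by
    rw [IsDedekindDomain.flat_iff_torsion_eq_bot, ← Submodule.isTorsionFree_iff_torsion_eq_bot]
    infer_instance
  have := Module.finitePresentation_of_finite R M
  exact Module.Flat.projective_of_finitePresentation

/-- The trace ideal of a nonzero finitely generated projective module over a domain is the
unit ideal. -/
theorem one_mem_span_dual_apply {P : Type u} [AddCommGroup P] [Module R P] [Module.Finite R P]
    [Module.IsTorsionFree R P] [Nontrivial P] :
    (1 : R) ∈ Submodule.span R {r : R | ∃ (f : P →ₗ[R] R) (x : P), f x = r} := by
  set I : Ideal R := Submodule.span R {r : R | ∃ (f : P →ₗ[R] R) (x : P), f x = r}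
  have := projective_of_isTorsionFree (R := R) (M := P)
  obtain ⟨s, hs⟩ := Module.projective_def'.1 this
  -- A section of a free cover provides a dual basis, so `P = IP`. Nakayama gives `r ≡ 1` modulo `I`
  -- killing `P`; torsion-freeness forces `r = 0`.
  have hI : (⊤ : Submodule R P) ≤ I • ⊤ := by
    intro x _
    have hx : Finsupp.linearCombination R id (s x) = x := LinearMap.congr_fun hs x
    rw [← hx, Finsupp.linearCombination_apply]
    exact Submodule.sum_mem _ fun y _ => Submodule.smul_mem_smul
      (Submodule.subset_span ⟨(Finsupp.lapply y).comp s, x, rfl⟩) trivial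
  obtain ⟨r, hr, hr'⟩ := Submodule.exists_sub_one_mem_and_smul_eq_zero_of_fg_of_le_smul I ⊤
    Module.Finite.fg_top hI
  obtain ⟨x, hx⟩ := exists_ne (0 : P)
  have hr0 : r = 0 := (smul_eq_zero.1 (hr' x trivial)).resolve_right hx
  rw [hr0, zero_sub] at hr
  simpa using I.neg_mem hr

/-- A finitely generated nontorsion module over a Dedekind domain is a generator. -/
theorem exists_surjective_of_isNontorsion {E : Type u} [AddCommGroup E] [Module R E]
    [Module.Finite R E] (hE : IsNontorsion R E) (L : Type u) [AddCommGroup L] [Module R L]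
    [Module.Finite R L] :
    ∃ (ι : Type) (_ : Fintype ι) (f : (ι → E) →ₗ[R] L), Function.Surjective f := by
  have : Nontrivial (E ⧸ Submodule.torsion R E) := by
    rw [Submodule.Quotient.nontrivial_iff]
    intro h
    obtain ⟨x, hx⟩ := hE
    have hx' : x ∈ Submodule.torsion R E := h ▸ Submodule.mem_top
    obtain ⟨⟨r, hr⟩, hrx⟩ := (Submodule.mem_torsion_iff _).1 hx'
    exact nonZeroDivisors.ne_zero hr (hx r hrx)
  obtain ⟨n, a, g, hg⟩ := Submodule.mem_span_set'.1
    (one_mem_span_dual_apply (R := R) (P := E ⧸ Submodule.torsion R E))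
  choose f x hfx using fun i => (g i).property
  choose y hy using fun i => Submodule.Quotient.mk_surjective _ (x i)
  -- Since the trace ideal of `E` modulo torsion contains `1`, a sum of functionals maps a power of
  -- `E` onto `R`; further powers then cover `L`.
  let φ : (Fin n → E) →ₗ[R] R :=
    ∑ i, ((f i).comp (Submodule.mkQ _)).comp (LinearMap.proj i)
  have hφ : φ (fun i => a i • y i) = 1 := by
    rw [← hg, LinearMap.sum_apply]
    refine Finset.sum_congr rfl fun i _ => ?_
    change f i (Submodule.Quotient.mk (a i • y i)) = _
    rw [Submodule.Quotient.mk_smul, map_smul, hy, hfx]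
  obtain ⟨m, π, hπ⟩ := Module.Finite.exists_fin' R L
  let ψ : (Fin m × Fin n → E) →ₗ[R] (Fin m → R) :=
    LinearMap.pi fun j => φ.comp (LinearMap.funLeft R E fun i => (j, i))
  refine ⟨Fin m × Fin n, inferInstance, π.comp ψ, hπ.comp fun r => ?_⟩
  refine ⟨fun p => r p.1 • a p.2 • y p.2, funext fun j => ?_⟩
  change φ (fun i => r j • a i • y i) = r j
  calc φ (fun i => r j • a i • y i) = r j • φ (fun i => a i • y i) := (map_smul φ (r j) _)
    _ = r j := by rw [hφ, smul_eq_mul, mul_one]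

end Dedekind

/-! ### Finitely generated modules as a hereditary category -/

section FGModuleCat

variable {R : Type u} [CommRing R]

theorem fgModuleCat_isZero_iff (M : FGModuleCat.{u} R) : IsZero M ↔ Subsingleton M := by
  constructor
  · intro h
    have h0 : 𝟙 M = 0 := h.eq_of_src _ _
    exact ⟨fun x y => by
      have (z : M) : z = 0 := congrArg (fun f : M ⟶ M => f.hom.hom z) h0
      rw [this x, this y]⟩
  · intro h
    rw [IsZero.iff_id_eq_zero]
    ext x
    exact Subsingleton.elim _ _

variable [IsNoetherianRing R]

theorem fgModuleCat_epi_iff {M N : FGModuleCat.{u} R} (f : M ⟶ N) :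
    Epi f ↔ Function.Surjective f.hom.hom := by
  rw [← ModuleCat.epi_iff_surjective]
  exact ((forget₂ (FGModuleCat R) (ModuleCat R)).epi_map_iff_epi f).symm

theorem fgModuleCat_mono_iff {M N : FGModuleCat.{u} R} (f : M ⟶ N) :
    Mono f ↔ Function.Injective f.hom.hom := by
  rw [← ModuleCat.mono_iff_injective]
  exact ((forget₂ (FGModuleCat R) (ModuleCat R)).mono_map_iff_mono f).symm

theorem fgModuleCat_exact_iff (S : ShortComplex (FGModuleCat.{u} R)) :
    S.Exact ↔ Function.Exact S.f.hom.hom S.g.hom.hom := by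
  rw [← S.exact_map_iff_of_faithful (forget₂ (FGModuleCat R) (ModuleCat R)),
    ShortComplex.ShortExact.moduleCat_exact_iff_function_exact]
  rfl

instance fgModuleCat_projective (M : FGModuleCat.{u} R) [Module.Projective R M] :
    Projective M where
  factors f e _ := by
    obtain ⟨g, hg⟩ := Module.projective_lifting_property e.hom.hom f.hom.hom
      ((fgModuleCat_epi_iff e).1 inferInstance)
    exact ⟨ObjectProperty.homMk (ModuleCat.ofHom g), FGModuleCat.hom_ext hg⟩

end FGModuleCat

section HereditaryFG

variable {R : Type u} [CommRing R] [IsDedekindDomain R]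

/-- The kernel of a free cover is torsion-free, hence projective. -/
theorem fgModuleCat_hasProjectiveDimensionLT (M : FGModuleCat.{u} R) :
    HasProjectiveDimensionLT M 2 := by
  obtain ⟨n, π, hπ⟩ := Module.Finite.exists_fin' R M
  let p : FGModuleCat.of R (Fin n → R) ⟶ M := ObjectProperty.homMk (ModuleCat.ofHom π)
  have : Epi p := (fgModuleCat_epi_iff p).2 hπ
  have hS : (ShortComplex.mk (kernel.ι p) p (kernel.condition p)).ShortExact :=
    { exact := ShortComplex.exact_kernel p }
  have : Module.IsTorsionFree R (kernel p : FGModuleCat.{u} R) :=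
    ((fgModuleCat_mono_iff (kernel.ι p)).1 inferInstance).moduleIsTorsionFree _
      fun r x => map_smul (kernel.ι p).hom.hom r x
  have := projective_of_isTorsionFree (R := R) (M := (kernel p : FGModuleCat.{u} R))
  have : Module.Projective R (FGModuleCat.of R (Fin n → R)) :=
    inferInstanceAs (Module.Projective R (Fin n → R))
  exact hS.hasProjectiveDimensionLT_X₃ 1 inferInstance inferInstance

theorem isHereditary_fgModuleCat [HasDerivedCategory.{w} (FGModuleCat.{u} R)] :
    IsHereditary (FGModuleCat.{u} R) := by
  have := hasExt_of_hasDerivedCategory (FGModuleCat.{u} R)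
  refine isHereditary_of_ext fun M N n hn => ?_
  have := fgModuleCat_hasProjectiveDimensionLT M
  exact HasProjectiveDimensionLT.subsingleton M 2 n hn N

theorem hom_stalk_pi_eq_zero [HasDerivedCategory.{w} (FGModuleCat.{u} R)]
    {X : DerivedCategory.Bounded (FGModuleCat.{u} R)} {l : ℤ} {L : FGModuleCat.{u} R}
    (h : ∀ f : X ⟶ (stalk l).obj L, f = 0) (ι : Type) [Fintype ι]
    (f : X ⟶ (stalk l).obj (FGModuleCat.of R (ι → L))) : f = 0 := by
  classical
  let q (i : ι) : FGModuleCat.of R (ι → L) ⟶ L :=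
    ObjectProperty.homMk (ModuleCat.ofHom (LinearMap.proj i))
  let j (i : ι) : L ⟶ FGModuleCat.of R (ι → L) :=
    ObjectProperty.homMk (ModuleCat.ofHom (LinearMap.single R (fun _ => L) i))
  have hid : 𝟙 (FGModuleCat.of R (ι → L)) = ∑ i, q i ≫ j i := by
    apply (forget₂ (FGModuleCat R) (ModuleCat R)).map_injective
    rw [Functor.map_sum]
    ext x
    rw [ModuleCat.hom_sum, LinearMap.sum_apply]
    exact (LinearMap.sum_single_apply _ _).symm
  rw [← Category.comp_id f, ← CategoryTheory.Functor.map_id, hid, Functor.map_sum,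
    Preadditive.comp_sum]
  refine Finset.sum_eq_zero fun i _ => ?_
  rw [Functor.map_comp, ← Category.assoc, h (f ≫ (stalk l).map (q i)), zero_comp]

/-- A finitely generated nontorsion module detects all finitely generated modules by morphisms
and extensions of degree one. -/
theorem isZero_of_hom_stalk_eq_zero [HasDerivedCategory.{w} (FGModuleCat.{u} R)]
    {M L : FGModuleCat.{u} R} (hL : IsNontorsion R L) (k : ℤ)
    (h₀ : ∀ f : (stalk k).obj M ⟶ (stalk k).obj L, f = 0)
    (h₁ : ∀ f : (stalk k).obj M ⟶ (stalk (k + 1)).obj L, f = 0) : IsZero M := by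
  have := hasExt_of_hasDerivedCategory (FGModuleCat.{u} R)
  have hpd := fgModuleCat_hasProjectiveDimensionLT M
  have hproj : Projective M := by
    -- As `Ext²(M, -) = 0`, the functor `Ext¹(M, -)` is right exact; it kills powers of `L`, hence
    -- their quotients, which are all modules.
    rw [projective_iff_subsingleton_ext_one]
    refine fun N => subsingleton_of_forall_eq 0 fun e => ?_
    obtain ⟨ι, _, π, hπ⟩ := exists_surjective_of_isNontorsion hL N
    let p : FGModuleCat.of R (ι → L) ⟶ N := ObjectProperty.homMk (ModuleCat.ofHom π)
    have : Epi p := (fgModuleCat_epi_iff p).2 hπ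
    have hS : (ShortComplex.mk (kernel.ι p) p (kernel.condition p)).ShortExact :=
      { exact := ShortComplex.exact_kernel p }
    have : Subsingleton ((stalk k).obj M ⟶ (stalk (k + 1)).obj (FGModuleCat.of R (ι → L))) :=
      subsingleton_of_forall_eq 0 (hom_stalk_pi_eq_zero h₁ ι)
    have := (stalkHomEquiv k (k + 1) 1 (by simp) M
      (FGModuleCat.of R (ι → L))).symm.subsingleton
    obtain ⟨x, rfl⟩ := Abelian.Ext.covariant_sequence_exact₃ M hS e (n₁ := 2) (by lia)
      (Abelian.Ext.eq_zero_of_hasProjectiveDimensionLT _ 2 le_rfl)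
    rw [Subsingleton.elim x 0, Abelian.Ext.zero_comp]
  obtain ⟨n, π, hπ⟩ := Module.Finite.exists_fin' R M
  let p : FGModuleCat.of R (Fin n → R) ⟶ M := ObjectProperty.homMk (ModuleCat.ofHom π)
  have : Epi p := (fgModuleCat_epi_iff p).2 hπ
  obtain ⟨x, hx⟩ := hL
  let s := Projective.factorThru (𝟙 M) p
  have hs : s ≫ p = 𝟙 M := Projective.factorThru_comp _ _
  -- The coordinates of `s` are functionals `M ⟶ R`. Composed with the injection `r ↦ r • x` into
  -- `L` they vanish by `h₀`.
  have hs0 : s = 0 := by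
    ext m i
    refine hx _ ?_
    let j : M ⟶ L := ObjectProperty.homMk (ModuleCat.ofHom
      ((LinearMap.toSpanSingleton R L x).comp ((LinearMap.proj i).comp s.hom.hom)))
    have hj : j = 0 := (stalk k).map_injective ((h₀ _).trans (Functor.map_zero _ _ _).symm)
    exact congrArg (fun f : M ⟶ L => f.hom.hom m) hj
  rw [IsZero.iff_id_eq_zero, ← hs, hs0, zero_comp]

theorem isZero_of_hom_eq_zero_of_isNontorsion {E L : FGModuleCat.{u} R} (hE : IsNontorsion R E)
    (h : ∀ f : E ⟶ L, f = 0) : IsZero L := by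
  classical
  rw [fgModuleCat_isZero_iff]
  obtain ⟨ι, _, π, hπ⟩ := exists_surjective_of_isNontorsion hE L
  refine subsingleton_of_forall_eq 0 fun y => ?_
  obtain ⟨x, rfl⟩ := hπ y
  have hπ0 : π = 0 := by
    refine LinearMap.pi_ext' fun i => ?_
    exact congrArg (fun f : E ⟶ L => f.hom.hom)
      (h (ObjectProperty.homMk (ModuleCat.ofHom (π.comp (LinearMap.single R (fun _ => E) i)))))
  rw [hπ0, LinearMap.zero_apply]

end HereditaryFG

/-! ### Torsion theories -/

section NoetherianTorsion

variable {R : Type u} [CommRing R] [IsNoetherianRing R]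

/-- Over a Noetherian ring, every right orthogonal subcategory is a torsionfree class. -/
theorem isTorsionfreeClass_rightOrthogonal (T : ObjectProperty (FGModuleCat.{u} R)) :
    IsTorsionfreeClass T.rightOrthogonal := by
  refine ⟨T.rightOrthogonal.leftOrthogonal, inferInstance, inferInstance,
    fun X Y hX hY f => hX f hY, fun X => ?_⟩
  let P : Submodule R X → Prop := fun S =>
    T.rightOrthogonal.leftOrthogonal (FGModuleCat.of R S)
  have hbot : P ⊥ := fun Y f _ =>
    ((fgModuleCat_isZero_iff _).2 (inferInstanceAs (Subsingleton (⊥ : Submodule R X)))).eq_of_src _ _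
  -- The torsion part is a maximal torsion submodule. If `N` is torsion and maps to the quotient,
  -- the preimage `S'` of its image is an extension of torsion modules, hence torsion; maximality
  -- forces `S' = S`.
  obtain ⟨S, hS, hmax⟩ := WellFounded.has_min
    (inferInstance : WellFoundedGT (Submodule R X)).wf {S | P S} ⟨⊥, hbot⟩
  let i : FGModuleCat.of R S ⟶ X := ObjectProperty.homMk (ModuleCat.ofHom S.subtype)
  let q : X ⟶ FGModuleCat.of R (X ⧸ S) := ObjectProperty.homMk (ModuleCat.ofHom S.mkQ)
  have hiq : i ≫ q = 0 := by
    ext x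
    exact (Submodule.Quotient.mk_eq_zero S).2 x.2
  have hi : Mono i := (fgModuleCat_mono_iff i).2 S.injective_subtype
  have hq : Epi q := (fgModuleCat_epi_iff q).2 S.mkQ_surjective
  refine ⟨ShortComplex.mk i q hiq, { exact := (fgModuleCat_exact_iff _).2 ?_ }, hS, rfl, ?_⟩
  · exact LinearMap.exact_subtype_mkQ S
  intro N g hN
  let S' : Submodule R X := (LinearMap.range g.hom.hom).comap S.mkQ
  have hSS' : S ≤ S' := fun x hx => ⟨0, by
    rw [map_zero]
    exact ((Submodule.Quotient.mk_eq_zero S).2 hx).symm⟩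
  have hS' : P S' := by
    intro F f hF
    have hfS : ∀ x : S', x.1 ∈ S → f.hom.hom x = 0 := by
      intro x hx
      have h0 := hS (ObjectProperty.homMk (ModuleCat.ofHom
        (f.hom.hom.comp (Submodule.inclusion hSS'))) : FGModuleCat.of R S ⟶ F) hF
      exact congrArg (fun f : FGModuleCat.of R S ⟶ F => f.hom.hom ⟨x.1, hx⟩) h0
    let φ : S' →ₗ[R] LinearMap.range g.hom.hom :=
      (S.mkQ.comp S'.subtype).codRestrict _ fun x => x.2
    have hφ : Function.Surjective φ := by
      rintro ⟨y, hy⟩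
      obtain ⟨x, rfl⟩ := S.mkQ_surjective y
      exact ⟨⟨x, hy⟩, rfl⟩
    have hker : LinearMap.ker φ ≤ LinearMap.ker f.hom.hom := by
      intro x hx
      refine hfS x ((Submodule.Quotient.mk_eq_zero S).1 ?_)
      exact congrArg Subtype.val hx
    let ψ : LinearMap.range g.hom.hom →ₗ[R] F :=
      ((LinearMap.ker φ).liftQ f.hom.hom hker).comp
        (φ.quotKerEquivOfSurjective hφ).symm.toLinearMap
    have hψ : ∀ x : S', ψ (φ x) = f.hom.hom x := by
      intro x
      have : (φ.quotKerEquivOfSurjective hφ).symm (φ x) = Submodule.Quotient.mk x := by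
        rw [LinearEquiv.symm_apply_eq]
        rfl
      change (LinearMap.ker φ).liftQ f.hom.hom hker
        ((φ.quotKerEquivOfSurjective hφ).symm (φ x)) = _
      rw [this]
      rfl
    have h0 := hF (ObjectProperty.homMk (ModuleCat.ofHom
      (ψ.comp g.hom.hom.rangeRestrict)) : N ⟶ F) hN
    ext x
    obtain ⟨n, hn⟩ := x.2
    have hx : φ x = g.hom.hom.rangeRestrict n := Subtype.ext hn.symm
    change f.hom.hom x = 0
    rw [← hψ x, hx]
    exact congrArg (fun f : N ⟶ F => f.hom.hom n) h0
  have hSeq : S' = S := by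
    by_contra hne
    exact hmax S' hS' (lt_of_le_of_ne hSS' (Ne.symm hne))
  ext n
  obtain ⟨x, hx⟩ := S.mkQ_surjective (g.hom.hom n)
  have hxS : x ∈ S := by
    rw [← hSeq]
    exact ⟨n, hx.symm⟩
  exact hx.symm.trans ((Submodule.Quotient.mk_eq_zero S).2 hxS)

theorem isTorsionfreeClass_top :
    IsTorsionfreeClass (⊤ : ObjectProperty (FGModuleCat.{u} R)) := by
  convert isTorsionfreeClass_rightOrthogonal (R := R) IsZero
  ext X
  exact ⟨fun _ Y f hY => hY.eq_of_src _ _, fun _ => trivial⟩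

end NoetherianTorsion

section TorsionTheory

variable {A : Type u} [Category.{v} A] [Abelian A]

theorem IsTorsionTheory.eq_rightOrthogonal {T F : ObjectProperty A} (h : IsTorsionTheory T F) :
    F = T.rightOrthogonal := by
  ext X
  refine ⟨fun hX Y f hY => h.hom_eq_zero hY hX f, fun hX => ?_⟩
  obtain ⟨S, hS, h₁, rfl, h₃⟩ := h.exists_shortExact X
  have := hS.epi_g
  have : Mono S.g := hS.exact.mono_g (hX _ h₁)
  have : IsIso S.g := isIso_of_mono_of_epi _
  exact h.torsionfree_closedUnderIso.of_iso (asIso S.g).symm h₃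

theorem IsTorsionfreeClass.eq_rightOrthogonal {F : ObjectProperty A} (h : IsTorsionfreeClass F) :
    F = F.leftOrthogonal.rightOrthogonal := by
  obtain ⟨T, hT⟩ := h
  refine le_antisymm (fun X hX Y f hY => hY f hX) fun X hX => ?_
  rw [hT.eq_rightOrthogonal]
  exact fun Y f hY => hX f fun Z g hZ => hT.hom_eq_zero hY hZ g

theorem IsTorsionfreeClass.exists_shortExact {F : ObjectProperty A} (h : IsTorsionfreeClass F)
    (X : A) : ∃ S : ShortComplex A, S.ShortExact ∧ F.leftOrthogonal S.X₁ ∧ S.X₂ = X ∧ F S.X₃ := by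
  obtain ⟨T, hT⟩ := h
  obtain ⟨S, hS, h₁, h₂, h₃⟩ := hT.exists_shortExact X
  exact ⟨S, hS, fun Z g hZ => hT.hom_eq_zero h₁ hZ g, h₂, h₃⟩

end TorsionTheory

/-! ### The homology sequence of a t-structure -/

section Classification

variable {A : Type u} [Category.{v} A] [Abelian A] [HasDerivedCategory.{w} A]
  (t : TStructure (DerivedCategory.Bounded A))

theorem ge_stalk_of_le {j k : ℤ} (h : j ≤ k) {M : A} (hM : t.ge 0 ((stalk k).obj M)) :
    t.ge 0 ((stalk j).obj M) :=
  (t.ge 0).prop_of_iso (stalkShiftIso k (j - k) j (by lia) M)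
    (t.ge_antitone (by lia) _ (t.ge_shift 0 (j - k) (k - j) (by lia) _ hM))

theorem le_stalk_of_le {j k : ℤ} (h : j ≤ k) {M : A} (hM : t.le (-1) ((stalk j).obj M)) :
    t.le (-1) ((stalk k).obj M) :=
  (t.le (-1)).prop_of_iso (stalkShiftIso j (k - j) k (by lia) M)
    (t.le_monotone (by lia) _ (t.le_shift (-1) (k - j) (-1 - (k - j)) (by lia) _ hM))

theorem eq_zero_of_le_of_ge {X Y : DerivedCategory.Bounded A} (hX : t.le (-1) X)
    (hY : t.ge 0 Y) (f : X ⟶ Y) : f = 0 :=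
  t.zero_of_isLE_of_isGE f (-1) 0 (by lia) ⟨hX⟩ ⟨hY⟩

theorem hom_eq_zero_of_le_of_ge {k : ℤ} {M N : A} (hM : t.le (-1) ((stalk k).obj M))
    (hN : t.ge 0 ((stalk k).obj N)) (f : M ⟶ N) : f = 0 :=
  (stalk k).map_injective
    ((eq_zero_of_le_of_ge t hM hN _).trans (Functor.map_zero _ _ _).symm)

variable (hA : IsHereditary A)

include hA

theorem geHomology_of_le {k : ℤ} (h : ∀ M : A, t.le (-1) ((stalk (k - 1)).obj M) → IsZero M)
    {X : DerivedCategory.Bounded A} (hX : t.le (-1) X) : geHomology k X :=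
  fun j hj => h _ (le_stalk_of_le t (by lia) (tStructure_le_stalk hA t hX j))

theorem ge_stalk_of_isZero {j k : ℤ}
    (h : ∀ M : A, t.le (-1) ((stalk (k - 1)).obj M) → IsZero M) (hj : j < k) (M : A) :
    t.ge 0 ((stalk j).obj M) := by
  rw [t.ge_iff_isGE, t.isGE_iff_orthogonal (-1) 0 (by lia)]
  exact fun X f hX => eq_zero_of_geHomology_of_leHomology f hj
    (geHomology_of_le t hA h hX.le) (leHomology_stalk j M)

/-- The hypothesis confines `D^{≤-1}` to degrees at least `k`. From such an object, a map to a stalk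
in degree `k` factors through `H_k`, so only Hom between modules matters. -/
theorem ge_stalk_iff {k : ℤ} (h : ∀ M : A, t.ge 0 ((stalk (k - 1)).obj M)) (M : A) :
    t.ge 0 ((stalk k).obj M) ↔
      ObjectProperty.rightOrthogonal (fun N => t.le (-1) ((stalk k).obj N)) M := by
  refine ⟨fun hM N f hN => hom_eq_zero_of_le_of_ge t hN hM f, fun hM => ?_⟩
  rw [t.ge_iff_isGE, t.isGE_iff_orthogonal (-1) 0 (by lia)]
  intro X f hX
  have hXk : geHomology k X := geHomology_of_le t hA (fun N hN => by
    rw [IsZero.iff_id_eq_zero]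
    exact hom_eq_zero_of_le_of_ge t hN (h N) _) hX.le
  obtain ⟨P, hP, a, g, b, hT⟩ := exists_bottom_triangle hXk
  obtain ⟨ψ, rfl⟩ := distTriang_desc₂ hT f (eq_zero_of_geHomology_of_leHomology _
    (by lia) hP (leHomology_stalk k M))
  obtain ⟨φ, rfl⟩ := (stalk k).map_surjective ψ
  rw [hM φ (tStructure_le_stalk hA t hX.le k), Functor.map_zero, comp_zero]

end Classification

section Dedekind

variable {R : Type u} [CommRing R] [IsDedekindDomain R]

theorem isNonzero_top : IsNonzero (⊤ : ObjectProperty (FGModuleCat.{u} R)) :=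
  ⟨FGModuleCat.of R R, trivial, fun h =>
    not_subsingleton R ((fgModuleCat_isZero_iff (FGModuleCat.of R R)).1 h)⟩

variable [HasDerivedCategory.{w} (FGModuleCat.{u} R)]
  (t : TStructure (DerivedCategory.Bounded (FGModuleCat.{u} R)))

/-- If the image of `1` in `H_k Y` has zero annihilator, `H_k Y` is nontorsion. Otherwise some `r ≠
0` kills it, and a lift of `r` to `H_k X` has zero annihilator because `R` is a domain. -/
theorem exists_isNontorsion (k : ℤ) :
    (∃ E : FGModuleCat.{u} R, IsNontorsion R E ∧ t.le (-1) ((stalk k).obj E)) ∨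
      ∃ L : FGModuleCat.{u} R, IsNontorsion R L ∧ t.ge 0 ((stalk k).obj L) := by
  obtain ⟨X, Y, hX, hY, f, g, h, hT⟩ :=
    t.exists_triangle ((stalk k).obj (FGModuleCat.of R R)) (-1) 0 (by lia)
  have hex := (fgModuleCat_exact_iff _).1 (homology_exact hT k)
  let e := FGModuleCat.isoToLinearEquiv (stalkHomologyIso k (FGModuleCat.of R R))
  have hX' := tStructure_le_stalk isHereditary_fgModuleCat t hX k
  have hY' := tStructure_ge_stalk isHereditary_fgModuleCat t hY k
  by_cases hL : IsNontorsion R ((homology k).obj Y : FGModuleCat.{u} R)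
  · exact Or.inr ⟨_, hL, hY'⟩
  · left
    refine ⟨_, ?_, hX'⟩
    unfold IsNontorsion at hL
    push Not at hL
    obtain ⟨r, hr, hr0⟩ := hL (((homology k).map g).hom.hom (e.symm (1 : R)))
    obtain ⟨x, hx⟩ := (hex (r • e.symm (1 : R))).1 (by
      rw [← hr]
      exact map_smul _ _ _)
    refine ⟨x, fun s hs => ?_⟩
    have h0 : s • r • e.symm (1 : R) = 0 := by
      rw [← hx]
      refine (map_smul ((homology k).map f).hom.hom s x).symm.trans ?_
      rw [hs, map_zero]
    rw [smul_smul, ← map_smul, LinearEquiv.map_eq_zero_iff] at h0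
    have h1 : s * r * 1 = 0 := h0
    rw [mul_one] at h1
    exact (mul_eq_zero.1 h1).resolve_right hr0

theorem isZero_or_ge_stalk (k : ℤ) :
    (∀ L : FGModuleCat.{u} R, t.ge 0 ((stalk k).obj L) → IsZero L) ∨
      ∀ j < k, ∀ M : FGModuleCat.{u} R, t.ge 0 ((stalk j).obj M) := by
  rcases exists_isNontorsion t k with ⟨E, hE, hE'⟩ | ⟨L, hL, hL'⟩
  · exact Or.inl fun L hL => isZero_of_hom_eq_zero_of_isNontorsion hE
      (hom_eq_zero_of_le_of_ge t hE' hL)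
  · refine Or.inr fun j hj => ge_stalk_of_isZero t isHereditary_fgModuleCat (fun M hM => ?_) hj
    have hL'' : t.ge 0 ((stalk (k - 1 + 1)).obj L) := by rwa [sub_add_cancel]
    exact isZero_of_hom_stalk_eq_zero hL (k - 1)
      (eq_zero_of_le_of_ge t hM (ge_stalk_of_le t (by lia) hL'))
      (eq_zero_of_le_of_ge t hM hL'')

theorem mu_ge_mem_torsionfreeStepSequences :
    mu (t.ge 0) ∈ torsionfreeStepSequences (FGModuleCat.{u} R) := by
  have hmu := mu_ge_iff isHereditary_fgModuleCat t 0
  have hstep : ∀ k : ℤ, (∃ L, t.ge 0 ((stalk k).obj L) ∧ ¬ IsZero L) →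
      ∀ j < k, ∀ M : FGModuleCat.{u} R, t.ge 0 ((stalk j).obj M) := by
    rintro k ⟨L, hL, hL0⟩
    exact (isZero_or_ge_stalk t k).resolve_left fun h => hL0 (h L hL)
  by_cases hne : ∃ k : ℤ, ∃ L, t.ge 0 ((stalk k).obj L) ∧ ¬ IsZero L
  · by_cases hb : ∃ b : ℤ, ∀ k : ℤ, (∃ L, t.ge 0 ((stalk k).obj L) ∧ ¬ IsZero L) → k ≤ b
    · obtain ⟨n, hn, hmax⟩ := Int.exists_greatest_of_bdd hb hne
      refine ⟨((n : WithTop ℤ) : WithBot (WithTop ℤ)), fun M => t.ge 0 ((stalk n).obj M), ?_, hn, ?_⟩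
      · have hC : (fun M : FGModuleCat.{u} R => t.ge 0 ((stalk n).obj M)) =
            ObjectProperty.rightOrthogonal (fun N => t.le (-1) ((stalk n).obj N)) := by
          ext M
          exact ge_stalk_iff t isHereditary_fgModuleCat (hstep n hn (n - 1) (by lia)) M
        rw [hC]
        exact isTorsionfreeClass_rightOrthogonal _
      · funext k
        ext M
        rw [hmu]
        simp only [stepSequence, WithBot.coe_lt_coe, WithTop.coe_lt_coe, WithBot.coe_inj,
          WithTop.coe_inj]
        rcases lt_trichotomy k n with h | rfl | h
        · exact iff_of_true (hstep n hn k h M) (Or.inl h)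
        · simp
        · simp only [h, h.not_gt, h.ne', false_and, true_and, false_or]
          refine ⟨fun hM => ?_, fun hM =>
            tStructure_ge_of_isZero t 0 ((stalk k).map_isZero hM)⟩
          by_contra hM0
          exact absurd (hmax k ⟨M, hM, hM0⟩) (by lia)
    · push Not at hb
      -- For infinite `n` the class never occurs in the sequence, so any nonzero torsionfree class
      -- serves.
      refine ⟨⊤, ⊤, isTorsionfreeClass_top, isNonzero_top, ?_⟩
      funext k
      ext M
      rw [hmu]
      obtain ⟨l, hl, hkl⟩ := hb k
      exact iff_of_true (hstep l hl k hkl M) (Or.inl (WithBot.coe_lt_coe.2 (WithTop.coe_lt_top k)))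
  · push Not at hne
    refine ⟨⊥, ⊤, isTorsionfreeClass_top, isNonzero_top, ?_⟩
    funext k
    ext M
    rw [hmu]
    simp only [stepSequence, not_lt_bot, WithBot.bot_lt_coe, WithBot.coe_ne_bot, false_and,
      true_and, false_or]
    exact ⟨hne k M, fun hM => tStructure_ge_of_isZero t 0 ((stalk k).map_isZero hM)⟩

end Dedekind

/-! ### Aisles realising step sequences -/

section Existence

variable {A : Type u} [Category.{v} A] [Abelian A] [HasDerivedCategory.{w} A]

theorem coaisle_stalk_iff (U : ObjectProperty (DerivedCategory.Bounded A)) (k : ℤ) (M : A) :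
    coaisle U ((stalk (k + 1)).obj M) ↔ U.rightOrthogonal ((stalk k).obj M) := by
  let e := stalkShiftIso k 1 (k + 1) rfl M
  constructor
  · intro h X f hX
    apply eq_zero_of_shift 1
    have h0 := h hX (f⟦(1 : ℤ)⟧' ≫ e.hom)
    rwa [Preadditive.IsIso.comp_right_eq_zero] at h0
  · intro h X hX f
    obtain ⟨g, hg⟩ := (shiftFunctor (DerivedCategory.Bounded A) (1 : ℤ)).map_surjective (f ≫ e.inv)
    rw [h g hX, Functor.map_zero] at hg
    rw [← Preadditive.IsIso.comp_right_eq_zero f e.inv, hg]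

/-- The aisle of complexes with homology concentrated in degrees at least `m` and with torsion
homology in degree `m`. -/
def stepAisle (m : ℤ) (C : ObjectProperty A) : ObjectProperty (DerivedCategory.Bounded A) :=
  fun X => geHomology m X ∧ ∀ ⦃F : A⦄, C F → ∀ f : X ⟶ (stalk m).obj F, f = 0

variable (m : ℤ) (C : ObjectProperty A)

theorem geHomology_shift {k : ℤ} {X : DerivedCategory.Bounded A} (h : geHomology k X) :
    geHomology (k + 1) (X⟦(1 : ℤ)⟧) :=
  fun j hj => (h (j - 1) (by lia)).of_iso (homologyShiftIso (j - 1) j (by lia) X)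

theorem geHomology_of_le_degree {k l : ℤ} (hkl : k ≤ l) {X : DerivedCategory.Bounded A}
    (h : geHomology l X) : geHomology k X :=
  fun j hj => h j (by lia)

theorem stepAisle_of_geHomology {X : DerivedCategory.Bounded A} (h : geHomology (m + 1) X) :
    stepAisle m C X :=
  ⟨geHomology_of_le_degree (by lia) h,
    fun F _ f => eq_zero_of_geHomology_of_leHomology f (by lia) h (leHomology_stalk m F)⟩

theorem stepAisle_stalk {N : A} (hN : C.leftOrthogonal N) : stepAisle m C ((stalk m).obj N) :=
  ⟨geHomology_stalk m N, fun F hF f => by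
    obtain ⟨g, rfl⟩ := (stalk m).map_surjective f
    rw [hN g hF, Functor.map_zero]⟩

theorem isPreaisle_stepAisle : IsPreaisle (stepAisle m C) where
  closedUnderIso := ⟨fun {X Y} e h => ⟨fun j hj => (h.1 j hj).of_iso ((homology j).mapIso e.symm),
    fun F hF f => by
      rw [← Preadditive.IsIso.comp_left_eq_zero e.hom]
      exact h.2 hF _⟩⟩
  closedUnderSuspension X h := stepAisle_of_geHomology m C (geHomology_shift h.1)
  closedUnderExtensions T hT h₁ h₃ := ⟨fun j hj =>
      (homology_exact (f := T.mor₁) (g := T.mor₂) (h := T.mor₃) hT j).isZero_of_both_zeros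
        ((h₁.1 j hj).eq_of_src _ _) ((h₃.1 j hj).eq_of_tgt _ _),
    fun F hF f => by
      obtain ⟨g, rfl⟩ := Triangle.yoneda_exact₂ T hT f (h₁.2 hF _)
      rw [h₃.2 hF g, comp_zero]⟩

variable {m C}

/-- Surjectivity of `p` keeps the homology of the fiber zero below `m`, and in degree `m` the long
exact sequence identifies it with `K`. Maps from the fiber to a stalk in degree `m` factor through
that homology, so they vanish on `C`. -/
theorem stepAisle_fiber {Z X : DerivedCategory.Bounded A} (hZ : geHomology m Z) {M F : A}
    {π : Z ⟶ (stalk m).obj M} (hπ : IsIso ((homology m).map π)) {K : A} {i : K ⟶ M} {p : M ⟶ F}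
    (hip : i ≫ p = 0) (hS : (ShortComplex.mk i p hip).ShortExact)
    (hK : C.leftOrthogonal K) {a : X ⟶ Z} {h : (stalk m).obj F ⟶ X⟦(1 : ℤ)⟧}
    (hT : Triangle.mk a (π ≫ (stalk m).map p) h ∈ distTriang (DerivedCategory.Bounded A)) :
    stepAisle m C X := by
  have := hS.mono_f
  have := hS.epi_g
  let θ := asIso ((homology m).map π) ≪≫ stalkHomologyIso m M
  have hθ : (homology m).map (π ≫ (stalk m).map p) ≫ (stalkHomologyIso m F).hom = θ.hom ≫ p := by
    rw [Functor.map_comp]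
    have := (DerivedCategory.singleFunctorCompHomologyFunctorIso A (-m)).hom.naturality p
    simp only [θ, Iso.trans_hom, asIso_hom, Category.assoc]
    exact congrArg (fun q => (homology m).map π ≫ q) this
  have hepi : Epi ((homology m).map (π ≫ (stalk m).map p)) := by
    have h0 : (homology m).map (π ≫ (stalk m).map p) =
        (θ.hom ≫ p) ≫ (stalkHomologyIso m F).inv := by
      rw [← hθ, Category.assoc, Iso.hom_inv_id, Category.comp_id]
    rw [h0]
    infer_instance
  have hX : geHomology m X := by
    intro j hj
    have : Mono ((homology j).map a) := by
      rw [homology_mono_iff_epi hT]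
      rcases (show j + 1 < m ∨ j + 1 = m by lia) with hj' | rfl
      · exact ⟨fun _ _ _ => ((geHomology_stalk m F) _ hj').eq_of_src _ _⟩
      · exact hepi
    exact (hZ j hj).of_mono ((homology j).map a)
  have hmono : Mono ((homology m).map a) :=
    homology_mono_of_isZero hT m (leHomology_stalk m F _ (by lia))
  have hcomp : (homology m).map a ≫ (homology m).map (π ≫ (stalk m).map p) = 0 :=
    homology_comp_eq_zero hT m
  refine ⟨hX, fun G hG f => ?_⟩
  obtain ⟨P, hP, _, g, _, hT'⟩ := exists_bottom_triangle hX
  obtain ⟨ψ, rfl⟩ := distTriang_desc₂ hT' f (eq_zero_of_geHomology_of_leHomology _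
    (by lia) hP (leHomology_stalk m G))
  obtain ⟨φ, rfl⟩ := (stalk m).map_surjective ψ
  have hφ : φ = 0 := by
    let u : (homology m).obj X ⟶ K := hS.exact.lift ((homology m).map a ≫ θ.hom) (by
      rw [Category.assoc]
      change _ ≫ θ.hom ≫ p = 0
      rw [← hθ, ← Category.assoc, hcomp, zero_comp])
    have hu : u ≫ i = (homology m).map a ≫ θ.hom := hS.exact.lift_f _ _
    let y : K ⟶ (homology m).obj X := (homology_exact hT m).lift (i ≫ θ.inv) (by
      change (i ≫ θ.inv) ≫ (homology m).map (π ≫ (stalk m).map p) = 0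
      rw [← Preadditive.IsIso.comp_right_eq_zero _ (stalkHomologyIso m F).hom, Category.assoc, hθ,
        Category.assoc, Iso.inv_hom_id_assoc, hip])
    have hy : y ≫ (homology m).map a = i ≫ θ.inv := (homology_exact hT m).lift_f _ _
    have huy : u ≫ y = 𝟙 _ := by
      rw [← cancel_mono ((homology m).map a), Category.assoc, hy, ← Category.assoc, hu,
        Category.assoc, Iso.hom_inv_id, Category.comp_id, Category.id_comp]
    rw [← Category.id_comp φ, ← huy, Category.assoc, hK (y ≫ φ) hG, comp_zero]
  rw [hφ, Functor.map_zero, comp_zero]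

theorem isAisle_stepAisle (m : ℤ) (hC : IsTorsionfreeClass C) : IsAisle (stepAisle m C) where
  toIsPreaisle := isPreaisle_stepAisle m C
  coreflective := by
    apply isLeftAdjoint_ι_of_exists
    intro X
    obtain ⟨Z, Q, hZ, hQ, z, q, δ, hT⟩ := exists_truncation X m
    obtain ⟨P, hP, j, π, ε, hT'⟩ := exists_bottom_triangle hZ
    have hπ := homology_isIso₂ hT' m (hP _ (by lia)) (hP _ (by lia))
    obtain ⟨⟨i, p, hip⟩, hS, hK, hM, hF⟩ := hC.exists_shortExact ((homology m).obj Z)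
    dsimp only at hM hK hF
    subst hM
    -- The coreflection: truncate to degrees at least `m`, then take the fiber of the map onto the
    -- torsionfree quotient of `H_m`.
    obtain ⟨Y, a, b, hT''⟩ := distinguished_cocone_triangle₁ (π ≫ (stalk m).map p)
    have hY : stepAisle m C Y := stepAisle_fiber hZ hπ hip hS hK hT''
    refine ⟨Y, hY, a ≫ z, fun W hW f => ?_⟩
    obtain ⟨g, rfl⟩ := distTriang_lift₂ hT f
      (eq_zero_of_geHomology_of_leHomology _ (by lia) hW.1 hQ)
    obtain ⟨g, rfl⟩ := distTriang_lift₂ hT'' g (hW.2 hF _)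
    refine ⟨g, (Category.assoc _ _ _).symm, fun g' hg' => sub_eq_zero.1 ?_⟩
    refine distTriang_eq_zero_of_comp₁ hT'' _ ?_ fun ψ =>
      eq_zero_of_geHomology_of_leHomology ψ (by lia) (geHomology_shift hW.1) (leHomology_stalk m _)
    refine distTriang_eq_zero_of_comp₁ hT _ ?_ fun ψ =>
      eq_zero_of_geHomology_of_leHomology ψ (by lia) (geHomology_shift hW.1) hQ
    rw [Preadditive.sub_comp, Preadditive.sub_comp, Category.assoc, hg', Category.assoc, sub_self]

theorem coaisle_stepAisle_stalk_iff (m : ℤ) (hC : IsTorsionfreeClass C) (k : ℤ) (M : A) :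
    coaisle (stepAisle m C) ((stalk (k + 1)).obj M) ↔
      k < m ∨ (k = m ∧ C M) ∨ (m < k ∧ IsZero M) := by
  rw [coaisle_stalk_iff]
  rcases lt_trichotomy k m with h | rfl | h
  · exact iff_of_true (fun X f hX => eq_zero_of_geHomology_of_leHomology f h hX.1
      (leHomology_stalk k M)) (Or.inl h)
  · simp only [lt_irrefl, false_and, true_and, or_false, false_or]
    refine ⟨fun h => ?_, fun hM X f hX => hX.2 hM f⟩
    rw [hC.eq_rightOrthogonal]
    intro N f hN
    exact (stalk k).map_injective
      ((h _ (stepAisle_stalk k C hN)).trans (Functor.map_zero _ _ _).symm)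
  · simp only [h, h.not_gt, h.ne', false_and, true_and, false_or]
    refine ⟨fun hM => ?_, fun hM X f _ => ((stalk k).map_isZero hM).eq_of_tgt _ _⟩
    rw [IsZero.iff_id_eq_zero]
    exact (stalk k).map_injective ((hM _ (stepAisle_of_geHomology m C
      (geHomology_of_le_degree h (geHomology_stalk k M)))).trans (Functor.map_zero _ _ _).symm)

theorem exists_tStructure_mu_eq (hA : IsHereditary A) (n : WithBot (WithTop ℤ))
    (hC : IsTorsionfreeClass C) :
    ∃ t : TStructure (DerivedCategory.Bounded A), mu (t.ge 0) = stepSequence n C := by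
  suffices H : ∃ t : TStructure (DerivedCategory.Bounded A), ∀ (k : ℤ) (M : A),
      coaisle (t.le 0) ((stalk (k + 1)).obj M) ↔ stepSequence n C (k + 1) M by
    obtain ⟨t, ht⟩ := H
    refine ⟨t, ?_⟩
    funext k
    ext M
    have h := ht (k - 1) M
    rw [sub_add_cancel] at h
    rw [mu_ge_iff hA, ge_zero_eq_coaisle, h]
  induction n using WithBot.recBotCoe with
  | bot =>
    refine ⟨tStructureOfTriangles ⊤ inferInstance (fun _ _ => trivial) fun X => ⟨X, _, trivial,
      fun W f _ => (isZero_zero _).eq_of_tgt _ _, _, _, _, contractible_distinguished X⟩,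
      fun k M => ?_⟩
    rw [tStructureOfTriangles_le_zero, coaisle_stalk_iff]
    simp only [stepSequence, not_lt_bot, WithBot.bot_lt_coe, WithBot.coe_ne_bot, false_and,
      true_and, false_or]
    refine ⟨fun hM => ?_, fun hM X f _ => ((stalk k).map_isZero hM).eq_of_tgt _ _⟩
    rw [IsZero.iff_id_eq_zero]
    exact (stalk k).map_injective ((hM _ trivial).trans (Functor.map_zero _ _ _).symm)
  | coe n =>
    induction n using WithTop.recTopCoe with
    | top =>
      refine ⟨tStructureOfTriangles IsZero ⟨fun e h => h.of_iso e.symm⟩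
        (fun X hX => (shiftFunctor _ (1 : ℤ)).map_isZero hX) fun X => ⟨_, X, isZero_zero _,
        fun W f hW => hW.eq_of_src _ _, _, _, _, contractible_distinguished₁ X⟩,
        fun k M => ?_⟩
      rw [tStructureOfTriangles_le_zero, coaisle_stalk_iff]
      exact iff_of_true (fun X f hX => hX.eq_of_src _ _)
        (Or.inl (WithBot.coe_lt_coe.2 (WithTop.coe_lt_top _)))
    | coe n =>
      -- The coaisle is orthogonal to `U[1]`, which starts one degree above `U`; hence `n - 1`.
      obtain ⟨t, ht⟩ := (isAisle_stepAisle (n - 1) hC).exists_tStructure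
      refine ⟨t, fun k M => ?_⟩
      rw [ht, coaisle_stepAisle_stalk_iff _ hC]
      simp only [stepSequence, WithBot.coe_lt_coe, WithTop.coe_lt_coe, WithBot.coe_inj,
        WithTop.coe_inj, lt_sub_iff_add_lt, eq_sub_iff_add_eq, sub_lt_iff_lt_add]

end Existence

section StepSequences

variable {A : Type u} [Category.{v} A]

theorem stepSequence_of_lt {n : WithBot (WithTop ℤ)} {k : ℤ}
    (h : ((k : WithTop ℤ) : WithBot (WithTop ℤ)) < n) (C : ObjectProperty A) :
    stepSequence n C k = ⊤ := by
  ext X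
  exact iff_of_true (Or.inl h) trivial

theorem stepSequence_of_eq {n : WithBot (WithTop ℤ)} {k : ℤ}
    (h : ((k : WithTop ℤ) : WithBot (WithTop ℤ)) = n) (C : ObjectProperty A) :
    stepSequence n C k = C := by
  ext X
  simp [stepSequence, ← h]

theorem stepSequence_of_gt {n : WithBot (WithTop ℤ)} {k : ℤ}
    (h : n < ((k : WithTop ℤ) : WithBot (WithTop ℤ))) (C : ObjectProperty A) :
    stepSequence n C k = IsZero := by
  ext X
  simp [stepSequence, h, h.not_gt, h.ne']

theorem isZero_of_stepSequence_succ {n : WithBot (WithTop ℤ)} {k : ℤ} {C : ObjectProperty A}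
    (h : n ≤ ((k : WithTop ℤ) : WithBot (WithTop ℤ))) {X : A}
    (hX : stepSequence n C (k + 1) X) : IsZero X := by
  rwa [stepSequence_of_gt (lt_of_le_of_lt h (WithBot.coe_lt_coe.2
    (WithTop.coe_lt_coe.2 (lt_add_one k))))] at hX

end StepSequences

/-! ### Step sequences are reflective and co-narrow -/

section CoNarrow

variable {A : Type u} [Category.{v} A] [Abelian A]

theorem isCoNarrow_rightOrthogonal (T : ObjectProperty A) : IsCoNarrow T.rightOrthogonal where
  closedUnderIso := inferInstance
  containsZero := inferInstance
  closedUnderExtensions := by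
    constructor
    intro S hS h₁ h₃ X f hX
    have h : f ≫ S.g = 0 := h₃ (f ≫ S.g) hX
    have := hS.mono_f
    rw [← hS.exact.lift_f f h, h₁ (hS.exact.lift f h) hX, zero_comp]
  closedUnderKernels := by
    have : T.rightOrthogonal.IsClosedUnderSubobjects := by
      constructor
      intro X Y i _ hY Z f hZ
      rw [← cancel_mono i, zero_comp]
      exact hY (f ≫ i) hZ
    infer_instance

theorem IsTorsionfreeClass.isRightAdjoint_ι {C : ObjectProperty A} (hC : IsTorsionfreeClass C) :
    C.ι.IsRightAdjoint := by
  apply isRightAdjoint_ι_of_exists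
  intro X
  obtain ⟨S, hS, h₁, rfl, h₃⟩ := hC.exists_shortExact X
  have := hS.epi_g
  refine ⟨S.X₃, h₃, S.g, fun W hW f => ?_⟩
  refine ⟨hS.exact.desc f (h₁ _ hW), hS.exact.g_desc _ _, fun g hg => ?_⟩
  rw [← cancel_epi S.g, hS.exact.g_desc]
  exact hg

open ZeroObject in
theorem isTorsionfreeClass_isZero : IsTorsionfreeClass (IsZero : ObjectProperty A) := by
  refine ⟨⊤, inferInstance, ⟨fun e h => h.of_iso e.symm⟩, fun _ _ _ hY f => hY.eq_of_tgt _ _,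
    fun X => ⟨ShortComplex.mk (𝟙 X) (0 : X ⟶ 0) comp_zero, ?_, trivial, rfl, isZero_zero A⟩⟩
  exact
    { exact := (ShortComplex.exact_iff_epi _ rfl).2 (inferInstanceAs (Epi (𝟙 X)))
      mono_f := inferInstanceAs (Mono (𝟙 X))
      epi_g := ⟨fun _ _ _ => (isZero_zero A).eq_of_src _ _⟩ }

/-- As `X₀ = 0`, the map `X₁ ⟶ X₂` is a kernel of `X₂ ⟶ X₃`. A map from `T` to `X₂` dies in `X₃`, so
it lifts to `X₁` and is zero. -/
theorem rightOrthogonal_of_exact {T : ObjectProperty A} {S : ComposableArrows A 4}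
    (hS : S.Exact) (h₀ : IsZero (S.obj 0)) (h₁ : T.rightOrthogonal (S.obj 1))
    (h₃ : T.rightOrthogonal (S.obj 3)) : T.rightOrthogonal (S.obj 2) := by
  intro X f hX
  have e₀ := hS.exact 0
  have e₁ := hS.exact 1
  have : Mono (S.map' 1 2) := e₀.mono_g (h₀.eq_of_src _ _)
  have h : f ≫ S.map' 2 3 = 0 := h₃ _ hX
  have : Mono (S.sc hS.toIsComplex 1).f := this
  rw [← e₁.lift_f f h]
  have hl : e₁.lift f h = 0 := h₁ _ hX
  rw [hl, zero_comp]

end CoNarrow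

section Noetherian

variable {R : Type u} [CommRing R] [IsNoetherianRing R]

theorem isTorsionfreeClass_stepSequence {C : ObjectProperty (FGModuleCat.{u} R)}
    (hC : IsTorsionfreeClass C) (n : WithBot (WithTop ℤ)) (k : ℤ) :
    IsTorsionfreeClass (stepSequence n C k) := by
  rcases lt_trichotomy ((k : WithTop ℤ) : WithBot (WithTop ℤ)) n with h | h | h
  · rw [stepSequence_of_lt h]
    exact isTorsionfreeClass_top
  · rwa [stepSequence_of_eq h]
  · rw [stepSequence_of_gt h]
    exact isTorsionfreeClass_isZero

theorem isReflectiveCoNarrowSequence_stepSequence {C : ObjectProperty (FGModuleCat.{u} R)}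
    (hC : IsTorsionfreeClass C) (n : WithBot (WithTop ℤ)) :
    IsReflectiveCoNarrowSequence (stepSequence n C) where
  coNarrow k := by
    rw [(isTorsionfreeClass_stepSequence hC n k).eq_rightOrthogonal]
    exact isCoNarrow_rightOrthogonal _
  antitone k := by
    rcases lt_or_ge ((k : WithTop ℤ) : WithBot (WithTop ℤ)) n with h | h
    · rw [stepSequence_of_lt h]
      exact le_top
    · intro X hX
      rw [(isTorsionfreeClass_stepSequence hC n k).eq_rightOrthogonal]
      exact fun Y f _ => (isZero_of_stepSequence_succ h hX).eq_of_tgt _ _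
  fiveTerm k S hS h₀ h₁ h₃ _ := by
    rcases lt_or_ge ((k : WithTop ℤ) : WithBot (WithTop ℤ)) n with h | h
    · exact Or.inl h
    · have hk := (isTorsionfreeClass_stepSequence hC n k).eq_rightOrthogonal
      rw [hk] at h₁ h₃ ⊢
      exact rightOrthogonal_of_exact hS (isZero_of_stepSequence_succ h h₀) h₁ h₃
  reflective k := (isTorsionfreeClass_stepSequence hC n k).isRightAdjoint_ι

end Noetherian

/-! ### Torsionfree classes and specialization closed subsets -/

section Support

variable {R : Type u} [CommRing R]

/-- Nonzero elements of the domain `R/p` have annihilator `p`, so an element of `M` with nonzero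
image has annihilator inside `p`. -/
theorem mem_support_of_hom_ne_zero {M : FGModuleCat.{u} R} {p : PrimeSpectrum R}
    {f : M ⟶ FGModuleCat.of R (R ⧸ p.asIdeal)} (hf : f ≠ 0) : p ∈ Module.support R M := by
  by_contra hp
  apply hf
  ext x
  by_contra hx
  refine hp (mem_support_of_le_annihilator (x := x) fun r hr => ?_)
  have h : r • f.hom.hom x = 0 := by
    refine (map_smul f.hom.hom r x).symm.trans ?_
    rw [hr, map_zero]
  obtain ⟨y, hy⟩ := Ideal.Quotient.mk_surjective (I := p.asIdeal) (f.hom.hom x)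
  have h' : Ideal.Quotient.mk p.asIdeal (r * y) = 0 := by
    rw [← h, ← hy]
    rfl
  refine (p.isPrime.mem_or_mem (Ideal.Quotient.eq_zero_iff_mem.1 h')).resolve_right fun hy' => ?_
  exact hx (hy.symm.trans (Ideal.Quotient.eq_zero_iff_mem.2 hy'))

theorem stableUnderSpecialization_supp (P : ObjectProperty (FGModuleCat.{u} R)) :
    StableUnderSpecialization (supp P) := by
  rintro p q hpq ⟨M, hM, hp⟩
  exact ⟨M, hM, Module.mem_support_mono ((PrimeSpectrum.le_iff_specializes p q).2 hpq) hp⟩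

theorem mem_support_quotient_iff {p q : PrimeSpectrum R} :
    q ∈ Module.support R (R ⧸ p.asIdeal) ↔ p ≤ q := by
  rw [Module.support_eq_zeroLocus, Ideal.annihilator_quotient]
  exact Iff.rfl

end Support

section Noetherian

variable {R : Type u} [CommRing R] [IsNoetherianRing R]

theorem exists_hom_ne_zero_of_mem_support {M : FGModuleCat.{u} R} {p : PrimeSpectrum R}
    (hp : p ∈ Module.support R M) :
    ∃ f : M ⟶ FGModuleCat.of R (R ⧸ p.asIdeal), f ≠ 0 := by
  obtain ⟨φ, hφ⟩ := exists_linearMap_ne_zero_of_mem_support hp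
  refine ⟨ObjectProperty.homMk (ModuleCat.ofHom φ), fun h => hφ ?_⟩
  ext x
  exact congrArg (fun f : M ⟶ FGModuleCat.of R (R ⧸ p.asIdeal) => f.hom.hom x) h

/-- The left orthogonal of a torsionfree class is determined by its support. -/
theorem IsTorsionfreeClass.leftOrthogonal_of_support_subset {C : ObjectProperty (FGModuleCat.{u} R)}
    (hC : IsTorsionfreeClass C) {N : FGModuleCat.{u} R}
    (hN : Module.support R N ⊆ supp C.leftOrthogonal) : C.leftOrthogonal N := by
  obtain ⟨S, hS, h₁, rfl, h₃⟩ := hC.exists_shortExact N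
  have := hS.epi_g
  have hzero : IsZero S.X₃ := by
    rw [fgModuleCat_isZero_iff]
    by_contra hne
    rw [not_subsingleton_iff_nontrivial] at hne
    -- An associated prime embeds `R/p` into the torsionfree quotient. Since `p` is in the support
    -- of a torsion module `M`, a nonzero map `M ⟶ R/p` contradicts orthogonality.
    obtain ⟨P, hP⟩ := associatedPrimes.nonempty R S.X₃
    obtain ⟨hP', x, hx⟩ := isAssociatedPrime_iff.1 hP
    let p : PrimeSpectrum R := ⟨P, hP'⟩
    have hxP : ∀ r : R, r • x = 0 ↔ r ∈ P := fun r => by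
      rw [hx, Submodule.mem_colon_singleton, Submodule.mem_bot]
    have hp : p ∈ Module.support R S.X₃ :=
      mem_support_of_le_annihilator (x := x) fun r hr => (hxP r).1 hr
    obtain ⟨M, hM, hpM⟩ := hN (Module.support_subset_of_surjective S.g.hom.hom
      ((fgModuleCat_epi_iff S.g).1 inferInstance) hp)
    obtain ⟨f, hf⟩ := exists_hom_ne_zero_of_mem_support hpM
    let i : FGModuleCat.of R (R ⧸ p.asIdeal) ⟶ S.X₃ := ObjectProperty.homMk (ModuleCat.ofHom
      (Submodule.liftQ P (LinearMap.toSpanSingleton R S.X₃ x) fun r hr => (hxP r).2 hr))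
    have hi : Mono i := by
      rw [fgModuleCat_mono_iff]
      refine (injective_iff_map_eq_zero i.hom.hom).2 fun y hy => ?_
      obtain ⟨r, rfl⟩ := Submodule.mkQ_surjective P y
      exact (Submodule.Quotient.mk_eq_zero P).2 ((hxP r).1 hy)
    apply hf
    rw [← cancel_mono i, zero_comp]
    exact hM (f ≫ i) h₃
  have : Epi S.f := hS.exact.epi_f (hzero.eq_of_tgt _ _)
  intro Y f hY
  rw [← cancel_epi S.f, comp_zero]
  exact h₁ (S.f ≫ f) hY

theorem IsTorsionfreeClass.le_iff {C C' : ObjectProperty (FGModuleCat.{u} R)}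
    (hC : IsTorsionfreeClass C) (hC' : IsTorsionfreeClass C') :
    C ≤ C' ↔ supp C'.leftOrthogonal ⊆ supp C.leftOrthogonal := by
  constructor
  · rintro h p ⟨M, hM, hp⟩
    exact ⟨M, fun Y f hY => hM f (h _ hY), hp⟩
  · intro h X hX
    rw [hC'.eq_rightOrthogonal]
    intro Y f hY
    exact hC.leftOrthogonal_of_support_subset
      (fun p hp => h ⟨Y, hY, hp⟩) f hX

/-- For `p` outside `Z`, the module `R/p` receives no nonzero map from a module supported in `Z`, so
it is torsionfree and no torsion module has `p` in its support. For `p` in `Z`, the support of `R/p`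
is the closure of `p`, which lies in `Z`. -/
theorem supp_leftOrthogonal_rightOrthogonal {Z : Set (PrimeSpectrum R)}
    (hZ : StableUnderSpecialization Z) :
    supp (ObjectProperty.rightOrthogonal
      (fun M : FGModuleCat.{u} R => Module.support R M ⊆ Z)).leftOrthogonal = Z := by
  ext p
  constructor
  · rintro ⟨M, hM, hp⟩
    by_contra hpZ
    obtain ⟨f, hf⟩ := exists_hom_ne_zero_of_mem_support hp
    refine hf (hM f fun N g hN => ?_)
    by_contra hg
    exact hpZ (hN (mem_support_of_hom_ne_zero hg))
  · intro hp
    refine ⟨FGModuleCat.of R (R ⧸ p.asIdeal), fun Y f hY => hY f fun q hq => ?_,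
      mem_support_quotient_iff.2 le_rfl⟩
    exact hZ ((PrimeSpectrum.le_iff_specializes p q).1 (mem_support_quotient_iff.1 hq)) hp

theorem bijOn_supp_leftOrthogonal :
    Set.BijOn (fun C : ObjectProperty (FGModuleCat.{u} R) => supp C.leftOrthogonal)
      {C | IsTorsionfreeClass C} {Z : Set (PrimeSpectrum R) | StableUnderSpecialization Z} :=
  ⟨fun _ _ => stableUnderSpecialization_supp _,
    fun _ hC _ hC' h => le_antisymm ((IsTorsionfreeClass.le_iff hC hC').2 h.ge)
      ((IsTorsionfreeClass.le_iff hC' hC).2 h.le),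
    fun _ hZ => ⟨_, isTorsionfreeClass_rightOrthogonal _, supp_leftOrthogonal_rightOrthogonal hZ⟩⟩

end Noetherian

/-! ### The bijections for t-structures and aisles -/

section Dedekind

variable {R : Type u} [CommRing R] [IsDedekindDomain R]
  [HasDerivedCategory.{w} (FGModuleCat.{u} R)]

theorem bijOn_mu_ge :
    Set.BijOn (fun t : TStructure (DerivedCategory.Bounded (FGModuleCat.{u} R)) => mu (t.ge 0))
      Set.univ (torsionfreeStepSequences (FGModuleCat.{u} R)) := by
  refine ⟨fun t _ => mu_ge_mem_torsionfreeStepSequences t, fun t _ t' _ h => ?_, ?_⟩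
  · apply tStructure_ext_ge
    rw [ge_eq_theta_mu isHereditary_fgModuleCat t, ge_eq_theta_mu isHereditary_fgModuleCat t']
    exact congrArg theta h
  · rintro _ ⟨n, C, hC, -, rfl⟩
    obtain ⟨t, ht⟩ := exists_tStructure_mu_eq isHereditary_fgModuleCat n hC
    exact ⟨t, trivial, ht⟩

theorem bijOn_mu_coaisle :
    Set.BijOn
      (fun U : ObjectProperty (DerivedCategory.Bounded (FGModuleCat.{u} R)) => mu (coaisle U))
      {U | IsAisle U} (torsionfreeStepSequences (FGModuleCat.{u} R)) := by
  refine ⟨fun U hU => ?_, fun U hU U' hU' h => ?_, fun S hS => ?_⟩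
  · obtain ⟨t, rfl⟩ := IsAisle.exists_tStructure hU
    simpa only [ge_zero_eq_coaisle] using mu_ge_mem_torsionfreeStepSequences t
  · obtain ⟨t, rfl⟩ := IsAisle.exists_tStructure hU
    obtain ⟨t', rfl⟩ := IsAisle.exists_tStructure hU'
    simp only [← ge_zero_eq_coaisle] at h
    rw [bijOn_mu_ge.injOn trivial trivial h]
  · obtain ⟨t, -, rfl⟩ := bijOn_mu_ge.surjOn hS
    exact ⟨t.le 0, isAisle_of_tStructure t, by simp only [ge_zero_eq_coaisle]⟩

end Dedekind

end DedekindAisles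

theorem mainTheorem7 (R : Type u) [CommRing R] [IsDedekindDomain R]
    [HasDerivedCategory.{w} (FGModuleCat.{u} R)] :
    -- the sequences in question are reflective co-narrow sequences
    (∀ S ∈ DedekindAisles.torsionfreeStepSequences (FGModuleCat.{u} R),
      DedekindAisles.IsReflectiveCoNarrowSequence S) ∧
    -- aisles correspond bijectively to these sequences, via the homology of the coaisle
    Set.BijOn
      (fun U : ObjectProperty (DerivedCategory.Bounded (FGModuleCat.{u} R)) =>
        DedekindAisles.mu (DedekindAisles.coaisle U))
      {U | DedekindAisles.IsAisle U}
      (DedekindAisles.torsionfreeStepSequences (FGModuleCat.{u} R)) ∧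
    (∀ U : ObjectProperty (DerivedCategory.Bounded (FGModuleCat.{u} R)),
      DedekindAisles.IsAisle U →
        DedekindAisles.coaisle U =
          DedekindAisles.theta (DedekindAisles.mu (DedekindAisles.coaisle U))) ∧
    -- the same for t-structures
    Set.BijOn
      (fun t : TStructure (DerivedCategory.Bounded (FGModuleCat.{u} R)) =>
        DedekindAisles.mu (t.ge 0))
      Set.univ
      (DedekindAisles.torsionfreeStepSequences (FGModuleCat.{u} R)) ∧
    (∀ t : TStructure (DerivedCategory.Bounded (FGModuleCat.{u} R)),
      DedekindAisles.IsAisle (t.le 0) ∧ t.ge 0 = DedekindAisles.coaisle (t.le 0) ∧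
        t.ge 0 = DedekindAisles.theta (DedekindAisles.mu (t.ge 0))) ∧
    -- torsionfree classes and specialization closed subsets
    Set.BijOn
      (fun C : ObjectProperty (FGModuleCat.{u} R) => DedekindAisles.supp C.leftOrthogonal)
      {C | DedekindAisles.IsTorsionfreeClass C}
      {Z : Set (PrimeSpectrum R) | StableUnderSpecialization Z} ∧
    (∀ C C' : ObjectProperty (FGModuleCat.{u} R),
      DedekindAisles.IsTorsionfreeClass C → DedekindAisles.IsTorsionfreeClass C' →
        (C ≤ C' ↔
          DedekindAisles.supp C'.leftOrthogonal ⊆ DedekindAisles.supp C.leftOrthogonal)) := by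
  refine ⟨?_, DedekindAisles.bijOn_mu_coaisle, fun U hU => ?_, DedekindAisles.bijOn_mu_ge,
    fun t => ⟨DedekindAisles.isAisle_of_tStructure t, DedekindAisles.ge_zero_eq_coaisle t,
      DedekindAisles.ge_eq_theta_mu DedekindAisles.isHereditary_fgModuleCat t 0⟩,
    DedekindAisles.bijOn_supp_leftOrthogonal, fun C C' hC hC' => hC.le_iff hC'⟩
  · rintro _ ⟨n, C, hC, -, rfl⟩
    exact DedekindAisles.isReflectiveCoNarrowSequence_stepSequence hC n
  · obtain ⟨t, rfl⟩ := DedekindAisles.IsAisle.exists_tStructure hU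
    rw [← DedekindAisles.ge_zero_eq_coaisle]
    exact DedekindAisles.ge_eq_theta_mu DedekindAisles.isHereditary_fgModuleCat t 0
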